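/- Let $N,K\ge 0$ be integers. Consider $N$ complex Higgs doublets $\Phi_1,\dots,\Phi_N$, each with four real components, $\Phi_n=\tfrac1{\sqrt2}(\varphi_{n,1}+i\varphi_{n,2},\ \varphi_{n,3}+i\varphi_{n,4})^T$, and $K$ real scalar singlets $s_1,\dots,s_K$. Let $\phi=(\phi_1,\dots,\phi_{4N+K})$ denote the collection of all the real scalar fields (the $\varphi_{n,c}$ and the $s_m$). Fix real constants $g,g',Y$ and an arbitrary real polynomial $V=V(\phi)$. For an integer $d\ge 1$ and the metric $\mathrm{diag}(1,-1,\dots,-1)$ on $\mathbb R^d$, let $$\mathcal L_d=\sum_{\mu=0}^{d-1}\Big(\sum_{n=1}^N (D_\mu\Phi_n)^\dagger D^\mu\Phi_n+\sum_{m=1}^K\tfrac12\,\partial_\mu s_m\,\partial^\mu s_m\Big)-V(\phi)-\sum_{\mu,\nu=0}^{d-1}\Big(\tfrac14 W^a_{\mu\nu}W^{a\mu\nu}+\tfrac14 B_{\mu\nu}B^{\mu\nu}\Big),$$ where $a,b,c$ are summed over $1,2,3$, $\sigma^a$ are the Pauli matrices, $W^a_\mu,B_\mu$ are real gauge fields,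 and $$D_\mu=\partial_\mu+ig\tfrac{\sigma^a}{2}W^a_\mu+ig'YB_\mu,\quad W^a_{\mu\nu}=\partial_\mu W^a_\nu-\partial_\nu W^a_\mu+g\,\epsilon^{abc}W^b_\mu W^c_\nu,\quad B_{\mu\nu}=\partial_\mu B_\nu-\partial_\nu B_\mu .$$ A point symmetry generator transforming only scalars is a vector field $X=\sum_i\eta_i(\phi)\,\partial_{\phi_i}$, where $\eta=(\eta_i)$ is smooth on an open set $U\subseteq\mathbb R^{4N+K}$ of scalar field values. For each $d$ it is regarded as a generator on the space of the spacetime coordinates and all the scalar and gauge fields (with zero components along the coordinates and the gauge fields), and $\operatorname{pr}X$ is its prolongation to all derivatives. It is a variational symmetry of $\mathcal L_d$ if $$\operatorname{pr}X(\mathcal L_d)=\sum_{\mu=0}^{d-1} d_\mu\beta^\mu$$ for some $\beta^\mu$ that are smooth functions of the coordinates, the fields and finitely many of their derivatives ($d_\mu$ being the total derivative); it is a strict variational symmetry if $\operatorname{pr}X(\mathcal L_d)=0$, and a divergence symmetry if it is variational but not strict. Then, for each $U$, the set of those $\eta$ that generate strict variational symmetries of $\mathcal L_d$, the set of those that generate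 divergence symmetries of $\mathcal L_d$, and hence the set of those that generate variational symmetries of $\mathcal L_d$, are the same for all spacetime dimensions $d\ge 1$. -/

import Mathlib

open scoped Matrix ContDiff

noncomputable section

namespace NHDM

/-! ## Jet space, differential functions, total derivatives -/

/-- Formal jet coordinates over `d` independent variables and dependent variables labelled by `ι`:
a point is `(x, y)` with `x μ` the spacetime coordinates and `y (i, J)` the formal coordinate
`y^i_J`, where `J = (j_0, …, j_{d-1})` is a multi-index (`J = 0` being the field itself). -/
abbrev Jet (d : ℕ) (ι : Type) : Type := (Fin d → ℝ) × (ι × (Fin d → ℕ) → ℝ)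

/-- The multi-index of a single derivative with respect to `x^μ`. -/
def unitIdx {d : ℕ} (μ : Fin d) : Fin d → ℕ := Pi.single μ 1

/-- The undifferentiated variables `(x, y)` of a point of jet space. -/
def Jet.base {d : ℕ} {ι : Type} (z : Jet d ι) : (Fin d → ℝ) × (ι → ℝ) :=
  (z.1, fun i => z.2 (i, 0))

/-- All jets whose undifferentiated variables lie in `Ω`. -/
def jetsOver {d : ℕ} {ι : Type} (Ω : Set ((Fin d → ℝ) × (ι → ℝ))) : Set (Jet d ι) :=
  {z | z.base ∈ Ω}

/-- Projection onto `x` and the finitely many jet coordinates in `S`. -/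
def Jet.proj {d : ℕ} {ι : Type} (S : Finset (ι × (Fin d → ℕ))) (z : Jet d ι) :
    (Fin d → ℝ) × (S → ℝ) :=
  (z.1, fun p => z.2 p)

/-- `f` is a local (differential) function on the set `M` of jets: a smooth function of `x` and of
finitely many of the coordinates `y^i_J`. -/
def IsLocalFunction {d : ℕ} {ι : Type} (M : Set (Jet d ι)) (f : Jet d ι → ℝ) : Prop :=
  ∃ (S : Finset (ι × (Fin d → ℕ))) (F : (Fin d → ℝ) × (S → ℝ) → ℝ),
    ContDiffOn ℝ ∞ F (Jet.proj S '' M) ∧ ∀ z ∈ M, f z = F (z.proj S)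

/-- The partial derivative `∂f/∂x^μ` on jet space. -/
def pderivX {d : ℕ} {ι : Type} (μ : Fin d) (f : Jet d ι → ℝ) (z : Jet d ι) : ℝ :=
  lineDeriv ℝ f z (Pi.single μ 1, 0)

/-- The partial derivative `∂f/∂y^i_J` on jet space, for `p = (i, J)`. -/
def pderivY {d : ℕ} {ι : Type} [DecidableEq ι] (p : ι × (Fin d → ℕ)) (f : Jet d ι → ℝ)
    (z : Jet d ι) : ℝ :=
  lineDeriv ℝ f z (0, Pi.single p 1)

/-- The total derivative `d_μ f = ∂f/∂x^μ + ∑_{i,J} y^i_{J+μ} ∂f/∂y^i_J`. The sum has finitely many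
nonzero terms when `f` is a local function. -/
def totalDeriv {d : ℕ} {ι : Type} [DecidableEq ι] (μ : Fin d) (f : Jet d ι → ℝ) :
    Jet d ι → ℝ := fun z =>
  pderivX μ f z + ∑ᶠ p : ι × (Fin d → ℕ), z.2 (p.1, p.2 + unitIdx μ) * pderivY p f z

/-- The iterated total derivative `D_J = (d/dx^0)^{j_0} ⋯ (d/dx^{d-1})^{j_{d-1}}`. -/
def iterTotalDeriv {d : ℕ} {ι : Type} [DecidableEq ι] (J : Fin d → ℕ) (f : Jet d ι → ℝ) :
    Jet d ι → ℝ :=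
  (List.finRange d).foldr (fun μ h => (totalDeriv μ)^[J μ] h) f

/-! ## Infinitesimal generators, prolongations, variational symmetries -/

/-- An infinitesimal generator `X = ξ^μ(x,y) ∂/∂x^μ + η^i(x,y) ∂/∂y^i` of point transformations. -/
structure Generator (d : ℕ) (ι : Type) where
  /-- the coefficients `ξ^μ` -/
  xi : Fin d → (Fin d → ℝ) × (ι → ℝ) → ℝ
  /-- the coefficients `η^i` -/
  eta : ι → (Fin d → ℝ) × (ι → ℝ) → ℝ

namespace Generator

variable {d : ℕ} {ι : Type} [DecidableEq ι]

/-- The characteristic `Q^i = η^i - ξ^μ y^i_μ`. -/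
def characteristic (X : Generator d ι) (i : ι) : Jet d ι → ℝ := fun z =>
  X.eta i z.base - ∑ μ, X.xi μ z.base * z.2 (i, unitIdx μ)

/-- The prolongation coefficients `η^i_J = D_J Q^i + ξ^μ y^i_{J+μ}` (so `η^i_0 = η^i`). -/
def coeff (X : Generator d ι) (i : ι) (J : Fin d → ℕ) : Jet d ι → ℝ := fun z =>
  iterTotalDeriv J (X.characteristic i) z + ∑ μ, X.xi μ z.base * z.2 (i, J + unitIdx μ)

/-- The prolongation `pr X = ξ^μ ∂/∂x^μ + ∑_{i,J} η^i_J ∂/∂y^i_J` acting on functions on jet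
space. -/
def prolong (X : Generator d ι) (f : Jet d ι → ℝ) : Jet d ι → ℝ := fun z =>
  ∑ μ, X.xi μ z.base * pderivX μ f z +
    ∑ᶠ p : ι × (Fin d → ℕ), X.coeff p.1 p.2 z * pderivY p f z

/-- The infinitesimal variation `pr X(L) + L d_μ ξ^μ` of the Lagrangian `L`. -/
def variation (X : Generator d ι) (L : Jet d ι → ℝ) : Jet d ι → ℝ := fun z =>
  X.prolong L z + L z * ∑ μ, totalDeriv μ (fun w => X.xi μ w.base) z

/-- `X` generates a strict variational symmetry of `L` (over the region `Ω` of variables `(x, y)`):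
`pr X(L) + L d_μ ξ^μ = 0`. -/
def IsStrictVariational (X : Generator d ι) (Ω : Set ((Fin d → ℝ) × (ι → ℝ)))
    (L : Jet d ι → ℝ) : Prop :=
  ∀ z ∈ jetsOver Ω, X.variation L z = 0

/-- `X` generates a variational symmetry of `L` (over the region `Ω`):
`pr X(L) + L d_μ ξ^μ = d_μ β^μ` for some local functions `β^μ`. -/
def IsVariational (X : Generator d ι) (Ω : Set ((Fin d → ℝ) × (ι → ℝ)))
    (L : Jet d ι → ℝ) : Prop :=
  ∃ β : Fin d → Jet d ι → ℝ, (∀ μ, IsLocalFunction (jetsOver Ω) (β μ)) ∧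
    ∀ z ∈ jetsOver Ω, X.variation L z = ∑ μ, totalDeriv μ (β μ) z

/-- `X` generates a divergence symmetry of `L`: it is variational, but one cannot choose
`β^μ = 0`. -/
def IsDivergence (X : Generator d ι) (Ω : Set ((Fin d → ℝ) × (ι → ℝ)))
    (L : Jet d ι → ℝ) : Prop :=
  X.IsVariational Ω L ∧ ¬ X.IsStrictVariational Ω L

end Generator

/-! ## The NHDM+KS Lagrangian -/

/-- Labels of the real scalar fields: `inl (n, c)` is the `c`-th real component of the doublet
`Φ_n`, and `inr m` is the singlet `s_m`. -/
abbrev ScalarIdx (N K : ℕ) : Type := (Fin N × Fin 4) ⊕ Fin K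

/-- Labels of the gauge fields: `inl (a, μ)` is `W^a_μ`, and `inr μ` is `B_μ`. -/
abbrev GaugeIdx (d : ℕ) : Type := (Fin 3 × Fin d) ⊕ Fin d

/-- Labels of all real fields in `d` spacetime dimensions. -/
abbrev FieldIdx (N K d : ℕ) : Type := ScalarIdx N K ⊕ GaugeIdx d

/-- The parameters of the theory: gauge couplings, hypercharge of the doublets, and the potential,
a real polynomial in the real scalar fields. -/
structure Model (N K : ℕ) where
  /-- the `SU(2)` gauge coupling `g` -/
  g : ℝ
  /-- the `U(1)` gauge coupling `g'` -/
  g' : ℝ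
  /-- the hypercharge `Y` of the doublets -/
  Y : ℝ
  /-- the potential `V(Φ, s)` -/
  V : MvPolynomial (ScalarIdx N K) ℝ

/-- The Minkowski metric `diag(1, -1, …, -1)` (its diagonal entries). -/
def metric {d : ℕ} (μ : Fin d) : ℝ := if (μ : ℕ) = 0 then 1 else -1

/-- The Pauli matrices. -/
def pauli : Fin 3 → Matrix (Fin 2) (Fin 2) ℂ :=
  ![!![0, 1; 1, 0], !![0, -Complex.I; Complex.I, 0], !![1, 0; 0, -1]]

/-- The complex doublet with given real components. -/
def doublet (c : Fin 4 → ℝ) : Fin 2 → ℂ :=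
  ((1 / √2 : ℝ) : ℂ) • ![c 0 + Complex.I * c 1, c 2 + Complex.I * c 3]

section Lagrangian

variable {N K d : ℕ}

/-- The jet coordinate `∂_J` of the `a`-th component of the `W` field, as a vector in `a`. -/
def jetW (z : Jet d (FieldIdx N K d)) (J : Fin d → ℕ) (μ : Fin d) : Fin 3 → ℝ :=
  fun a => z.2 (Sum.inr (Sum.inl (a, μ)), J)

/-- The jet coordinate `∂_J B_μ`. -/
def jetB (z : Jet d (FieldIdx N K d)) (J : Fin d → ℕ) (μ : Fin d) : ℝ :=
  z.2 (Sum.inr (Sum.inr μ), J)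

/-- The jet coordinate `∂_J Φ_n`. -/
def jetΦ (z : Jet d (FieldIdx N K d)) (J : Fin d → ℕ) (n : Fin N) : Fin 2 → ℂ :=
  doublet fun c => z.2 (Sum.inl (Sum.inl (n, c)), J)

/-- The jet coordinate `∂_J s_m`. -/
def jetS (z : Jet d (FieldIdx N K d)) (J : Fin d → ℕ) (m : Fin K) : ℝ :=
  z.2 (Sum.inl (Sum.inr m), J)

namespace Model

/-- The covariant derivative
`D_μ Φ_n = ∂_μ Φ_n + i g (σ^a / 2) W^a_μ Φ_n + i g' Y B_μ Φ_n`. -/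
def covDeriv (P : Model N K) (μ : Fin d) (n : Fin N) (z : Jet d (FieldIdx N K d)) : Fin 2 → ℂ :=
  jetΦ z (unitIdx μ) n
    + (Complex.I * P.g) • (∑ a, ((jetW z 0 μ a : ℂ) / 2) • (pauli a *ᵥ jetΦ z 0 n))
    + (Complex.I * P.g' * P.Y * jetB z 0 μ) • jetΦ z 0 n

/-- The field strength `W^a_{μν} = ∂_μ W^a_ν - ∂_ν W^a_μ + g ε^{abc} W^b_μ W^c_ν`; the last term is
the cross product of the vectors `W_μ` and `W_ν`. -/
def strengthW (P : Model N K) (μ ν : Fin d) (z : Jet d (FieldIdx N K d)) : Fin 3 → ℝ :=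
  jetW z (unitIdx μ) ν - jetW z (unitIdx ν) μ + P.g • (jetW z 0 μ ⨯₃ jetW z 0 ν)

/-- The field strength `B_{μν} = ∂_μ B_ν - ∂_ν B_μ`. -/
def strengthB (_P : Model N K) (μ ν : Fin d) (z : Jet d (FieldIdx N K d)) : ℝ :=
  jetB z (unitIdx μ) ν - jetB z (unitIdx ν) μ

/-- The kinetic terms of the gauge bosons,
`-∑_{μ,ν} (¼ W^a_{μν} W^{aμν} + ¼ B_{μν} B^{μν})`. -/
def gaugeKinetic (P : Model N K) (z : Jet d (FieldIdx N K d)) : ℝ :=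
  -∑ μ : Fin d, ∑ ν : Fin d, metric μ * metric ν *
    ((1 / 4) * (∑ a, P.strengthW μ ν z a ^ 2) + (1 / 4) * P.strengthB μ ν z ^ 2)

/-- The potential as a function of the undifferentiated scalar fields. -/
def potential (P : Model N K) (z : Jet d (FieldIdx N K d)) : ℝ :=
  MvPolynomial.eval (fun s => z.2 (Sum.inl s, 0)) P.V

/-- The NHDM+KS Lagrangian in `d` spacetime dimensions, as a function on jet space:
`∑_μ (∑_n (D_μ Φ_n)† D^μ Φ_n + ∑_m ½ ∂_μ s_m ∂^μ s_m) - V + T_GB`. -/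
def lagrangian (P : Model N K) (d : ℕ) (z : Jet d (FieldIdx N K d)) : ℝ :=
  (∑ μ : Fin d, metric μ *
      ((∑ n, (star (P.covDeriv μ n z) ⬝ᵥ P.covDeriv μ n z).re)
        + ∑ m, (1 / 2) * jetS z (unitIdx μ) m ^ 2))
    - P.potential z + P.gaugeKinetic z

end Model

end Lagrangian

/-! ## Scalar point symmetries -/

/-- The generator `X_d = η_s(φ) ∂/∂φ_s` in `d` dimensions, which transforms only the scalars:
`ξ^μ = 0`, and the coefficients belonging to the gauge fields vanish. -/
def scalarGenerator {N K : ℕ} (d : ℕ) (η : (ScalarIdx N K → ℝ) → ScalarIdx N K → ℝ) :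
    Generator d (FieldIdx N K d) where
  xi _ _ := 0
  eta i p := Sum.elim (fun s => η (fun t => p.2 (Sum.inl t)) s) (fun _ => 0) i

/-- The region of variables `(x, y)` with `x` and the gauge fields arbitrary, and the values of the
scalar fields in `U`. -/
def scalarRegion {N K : ℕ} (d : ℕ) (U : Set (ScalarIdx N K → ℝ)) :
    Set ((Fin d → ℝ) × (FieldIdx N K d → ℝ)) :=
  {p | (fun s => p.2 (Sum.inl s)) ∈ U}

namespace Model

variable {N K : ℕ}

/-- The strict variational Lie point symmetries of `L_d` transforming only scalars, as the set of
the coefficients `η`, smooth on the region `U` of scalar field values. -/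
def strictScalarSymmetries (P : Model N K) (d : ℕ) (U : Set (ScalarIdx N K → ℝ)) :
    Set ((ScalarIdx N K → ℝ) → ScalarIdx N K → ℝ) :=
  {η | ContDiffOn ℝ ∞ η U ∧
    (scalarGenerator d η).IsStrictVariational (scalarRegion d U) (P.lagrangian d)}

/-- The divergence Lie point symmetries of `L_d` transforming only scalars. -/
def divergenceScalarSymmetries (P : Model N K) (d : ℕ) (U : Set (ScalarIdx N K → ℝ)) :
    Set ((ScalarIdx N K → ℝ) → ScalarIdx N K → ℝ) :=
  {η | ContDiffOn ℝ ∞ η U ∧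
    (scalarGenerator d η).IsDivergence (scalarRegion d U) (P.lagrangian d)}

/-- All variational Lie point symmetries of `L_d` transforming only scalars. -/
def variationalScalarSymmetries (P : Model N K) (d : ℕ) (U : Set (ScalarIdx N K → ℝ)) :
    Set ((ScalarIdx N K → ℝ) → ScalarIdx N K → ℝ) :=
  {η | ContDiffOn ℝ ∞ η U ∧
    (scalarGenerator d η).IsVariational (scalarRegion d U) (P.lagrangian d)}

end Model

end NHDM

end

/-!
The variation of `L_d` under a scalar generator with coefficients `η` is
`∑ μ, metric μ * E(φ, ∂_μφ, W_μ, B_μ) - c(φ)`, where `c = η_s ∂V/∂φ_s` and where `E`, the variation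
of the kinetic term of one spacetime direction, is a quadratic form in `(∂_μφ, W_μ, B_μ)`. Neither
`E` nor `c` depends on `d` (`Model.variation_lagrangian`). The theorem follows from two
criteria on the open set `U` of scalar values, in which `d ≥ 1` no longer appears:

* `η` is a strict symmetry iff `E = 0` and `c = 0` (`isStrictVariational_iff`): jets whose only
  non-zero derivatives and gauge fields are those in the time direction separate the terms;
* `η` is a variational symmetry iff `E = 0` and `dc = 0` (`isVariational_iff`): if these hold, the
  variation is the divergence of `β^0 = -x^0 c(φ)`.

That a variational symmetry satisfies `E = 0` and `dc = 0` is seen without Euler operators. The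
integral of a total divergence does not change when the fields are changed on a compact set
(`integral_totalDeriv_sub_eq_zero`). Comparing the constant field `φ = p` with
`φ = p + δ χ v`, `W_μ = δ ∂_μχ w`, `B_μ = δ ∂_μχ b` for a test function `χ` gives
`∫ (δ² (∂_μχ ∂^μχ) E(p + δχv, v, w, b) - (c(p + δχv) - c(p))) = 0`, as `E` is quadratic. At first
order in `δ`, `dc(p) v * ∫ χ = 0`, so `dc = 0` and `c` is locally constant; then, at second order,
`E(p, v, w, b) * ∫ ∂_μχ ∂^μχ = 0` (`integral_eq_zero_of_forall_amplitude`). The last integral may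
vanish because the metric is indefinite, but not for all of `χ`, `χ cos x^0` and `χ sin x^0`:
by `gradSq_modulated` the sum of the integrals for the latter two exceeds that for `χ` by `∫ χ²`.
The functions `χ` are products of functions of one variable, so that all their partial derivatives
are explicit.
-/

noncomputable section

namespace NHDM

open MeasureTheory

/-! ### Local functions and total derivatives -/

section Jets

variable {d : ℕ} {ι : Type}

/-- Directional derivatives on jet space only involve the representative `F` of `f`, as lines in jet
space project to lines. -/
lemma lineDeriv_eq_fderiv_proj {S : Finset (ι × (Fin d → ℕ))} {O : Set ((Fin d → ℝ) × (S → ℝ))}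
    (hO : IsOpen O) {f : Jet d ι → ℝ} {F : (Fin d → ℝ) × (S → ℝ) → ℝ}
    (hf : ∀ z : Jet d ι, z.proj S ∈ O → f z = F (z.proj S)) {z : Jet d ι} (hz : z.proj S ∈ O)
    (hF : DifferentiableAt ℝ F (z.proj S)) (v : Jet d ι) :
    lineDeriv ℝ f z v = fderiv ℝ F (z.proj S) (Jet.proj S v) := by
  have hadd : ∀ t : ℝ, Jet.proj S (z + t • v) = z.proj S + t • Jet.proj S v := fun t => rfl
  have h1 : HasDerivAt (fun t : ℝ => F (z.proj S + t • Jet.proj S v))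
      (fderiv ℝ F (z.proj S) (Jet.proj S v)) 0 := hF.hasFDerivAt.hasLineDerivAt _
  refine (h1.congr_of_eventuallyEq ?_).deriv
  have hc : Continuous fun t : ℝ => z.proj S + t • Jet.proj S v := by fun_prop
  have h0 : ∀ᶠ t in nhds (0 : ℝ), z.proj S + t • Jet.proj S v ∈ O :=
    hc.continuousAt.eventually_mem (hO.mem_nhds (by simpa using hz))
  filter_upwards [h0] with t ht
  rw [hf _ (by rwa [hadd]), hadd]

/-- A family of functions `Y (i, J)` is holonomic if it consists of the derivatives of the fields
`Y (i, 0)`, in the sense that `∂_μ Y (i, J) = Y (i, J + μ)`. -/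
def IsHolonomic (Y : ι × (Fin d → ℕ) → (Fin d → ℝ) → ℝ) : Prop :=
  ∀ p, ContDiff ℝ 1 (Y p) ∧
    ∀ x μ, fderiv ℝ (Y p) x (Pi.single μ 1) = Y (p.1, p.2 + unitIdx μ) x

/-- The section `x ↦ (x, Y(x))` of jet space given by the functions `Y (i, J)`. -/
def jetSection (Y : ι × (Fin d → ℕ) → (Fin d → ℝ) → ℝ) (x : Fin d → ℝ) : Jet d ι :=
  (x, fun p => Y p x)

/-- Over an open region, a local function has a representative on an open subset of a
finite-dimensional space of jets that is large enough to detect the region. -/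
lemma IsLocalFunction.exists_contDiffOn [Fintype ι] {Ω : Set ((Fin d → ℝ) × (ι → ℝ))}
    (hΩ : IsOpen Ω) {f : Jet d ι → ℝ} (hf : IsLocalFunction (jetsOver Ω) f) :
    ∃ (S : Finset (ι × (Fin d → ℕ))) (O : Set ((Fin d → ℝ) × (S → ℝ)))
      (F : (Fin d → ℝ) × (S → ℝ) → ℝ), IsOpen O ∧ ContDiffOn ℝ ∞ F O ∧
        (∀ z : Jet d ι, z.proj S ∈ O ↔ z ∈ jetsOver Ω) ∧
        ∀ z : Jet d ι, z.proj S ∈ O → f z = F (z.proj S) := by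
  classical
  obtain ⟨S, F, hF, hfF⟩ := hf
  let S' : Finset (ι × (Fin d → ℕ)) := S ∪ Finset.univ.image fun i => (i, 0)
  have hS : ∀ p ∈ S, p ∈ S' := fun p hp => Finset.mem_union_left _ hp
  have h0 : ∀ i : ι, (i, (0 : Fin d → ℕ)) ∈ S' := fun i =>
    Finset.mem_union_right _ (Finset.mem_image_of_mem _ (Finset.mem_univ i))
  let b : (Fin d → ℝ) × (S' → ℝ) → (Fin d → ℝ) × (ι → ℝ) :=
    fun w => (w.1, fun i => w.2 ⟨(i, 0), h0 i⟩)
  let r : (Fin d → ℝ) × (S' → ℝ) → (Fin d → ℝ) × (S → ℝ) :=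
    fun w => (w.1, fun p => w.2 ⟨p.1, hS _ p.2⟩)
  have hb : Continuous b := by fun_prop
  have hr : ContDiff ℝ ∞ r := by fun_prop
  have hmem : ∀ z : Jet d ι, z.proj S' ∈ b ⁻¹' Ω ↔ z ∈ jetsOver Ω := fun z => Iff.rfl
  refine ⟨S', b ⁻¹' Ω, F ∘ r, hΩ.preimage hb, hF.comp hr.contDiffOn ?_, hmem,
    fun z hz => hfF z hz⟩
  intro w hw
  -- every point of the finite-dimensional space is the projection of a jet
  refine ⟨(w.1, fun p => if hp : p ∈ S' then w.2 ⟨p, hp⟩ else 0), ?_, ?_⟩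
  · have : (fun i => if hp : (i, (0 : Fin d → ℕ)) ∈ S' then w.2 ⟨(i, 0), hp⟩ else 0) =
        fun i => w.2 ⟨(i, 0), h0 i⟩ := funext fun i => dif_pos (h0 i)
    change (w.1, fun i => if hp : (i, (0 : Fin d → ℕ)) ∈ S' then w.2 ⟨(i, 0), hp⟩ else 0) ∈ Ω
    rw [this]
    exact hw
  · exact Prod.ext rfl (funext fun p => dif_pos (hS _ p.2))

variable [DecidableEq ι]

/-- The total derivative of a local function is the derivative of its finite-dimensional
representative in the direction in which a holonomic section moves. -/
lemma totalDeriv_eq_fderiv_proj {S : Finset (ι × (Fin d → ℕ))} {O : Set ((Fin d → ℝ) × (S → ℝ))}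
    (hO : IsOpen O) {f : Jet d ι → ℝ} {F : (Fin d → ℝ) × (S → ℝ) → ℝ}
    (hf : ∀ z : Jet d ι, z.proj S ∈ O → f z = F (z.proj S)) {z : Jet d ι} (hz : z.proj S ∈ O)
    (hF : DifferentiableAt ℝ F (z.proj S)) (μ : Fin d) :
    totalDeriv μ f z =
      fderiv ℝ F (z.proj S) (Pi.single μ 1, fun p => z.2 (p.1.1, p.1.2 + unitIdx μ)) := by
  have hY : ∀ p : ι × (Fin d → ℕ), pderivY p f z =
      fderiv ℝ F (z.proj S) (0, fun q : S => (Pi.single p 1 : ι × (Fin d → ℕ) → ℝ) q) :=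
    fun p => lineDeriv_eq_fderiv_proj hO hf hz hF _
  have hX : pderivX μ f z = fderiv ℝ F (z.proj S) (Pi.single μ 1, 0) :=
    lineDeriv_eq_fderiv_proj hO hf hz hF _
  have hsupp : (Function.support fun p : ι × (Fin d → ℕ) =>
      z.2 (p.1, p.2 + unitIdx μ) * pderivY p f z) ⊆ S := by
    intro p hp
    by_contra hpS
    apply hp
    have : (fun q : S => (Pi.single p 1 : ι × (Fin d → ℕ) → ℝ) q) = 0 := by
      funext q
      exact Pi.single_eq_of_ne (fun h : q.1 = p => hpS (h ▸ q.2)) _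
    simp only [hY, this]
    rw [← Prod.zero_eq_mk, map_zero, mul_zero]
  have hvec : ((Pi.single μ 1, fun p : S => z.2 (p.1.1, p.1.2 + unitIdx μ)) :
        (Fin d → ℝ) × (S → ℝ)) = (Pi.single μ 1, 0) + ∑ p : S,
        z.2 (p.1.1, p.1.2 + unitIdx μ) •
          (0, fun q : S => (Pi.single p.1 1 : ι × (Fin d → ℕ) → ℝ) q) := by
    refine Prod.ext ?_ ?_
    · simp [Prod.fst_sum]
    · funext q
      simp only [Prod.snd_add, Prod.snd_sum, Prod.smul_snd, Pi.add_apply, Pi.zero_apply, zero_add,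
        Finset.sum_apply, Pi.smul_apply, smul_eq_mul]
      rw [Finset.sum_eq_single q]
      · simp
      · intro b _ hb
        rw [Pi.single_eq_of_ne (fun h => hb (Subtype.ext h.symm)), mul_zero]
      · simp
  rw [totalDeriv, finsum_eq_sum_of_support_subset _ hsupp, hX, hvec, map_add, map_sum,
    ← Finset.sum_coe_sort]
  simp only [hY, map_smul, smul_eq_mul]

/-- Along a holonomic section, a local function is continuously differentiable, and total
derivatives become partial derivatives. -/
lemma IsLocalFunction.comp_jetSection [Fintype ι] {Ω : Set ((Fin d → ℝ) × (ι → ℝ))}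
    (hΩ : IsOpen Ω) {f : Jet d ι → ℝ} (hf : IsLocalFunction (jetsOver Ω) f)
    {Y : ι × (Fin d → ℕ) → (Fin d → ℝ) → ℝ} (hY : IsHolonomic Y)
    (hYΩ : ∀ x, jetSection Y x ∈ jetsOver Ω) :
    ContDiff ℝ 1 (fun x => f (jetSection Y x)) ∧ ∀ x μ,
      fderiv ℝ (fun x => f (jetSection Y x)) x (Pi.single μ 1) =
        totalDeriv μ f (jetSection Y x) := by
  obtain ⟨S, O, F, hO, hF, hmem, hfF⟩ := hf.exists_contDiffOn hΩ
  have hxO : ∀ x, (jetSection Y x).proj S ∈ O := fun x => (hmem _).2 (hYΩ x)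
  have heq : (fun x => f (jetSection Y x)) = fun x => F ((jetSection Y x).proj S) :=
    funext fun x => hfF _ (hxO x)
  have hproj : ContDiff ℝ 1 fun x => (jetSection Y x).proj S :=
    contDiff_id.prodMk (contDiff_pi.2 fun p => (hY p.1).1)
  rw [heq]
  refine ⟨(hF.of_le (by simp)).comp_contDiff hproj hxO, fun x μ => ?_⟩
  have hFx : DifferentiableAt ℝ F ((jetSection Y x).proj S) :=
    (hF.contDiffAt (hO.mem_nhds (hxO x))).differentiableAt (by simp)
  have hp : HasFDerivAt (fun x => (jetSection Y x).proj S)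
      ((ContinuousLinearMap.id ℝ _).prod
        (ContinuousLinearMap.pi fun p : S => fderiv ℝ (Y p.1) x)) x :=
    (hasFDerivAt_id x).prodMk (hasFDerivAt_pi.2 fun p =>
      ((hY p.1).1.differentiable (by simp) x).hasFDerivAt)
  have hcomp := (hFx.hasFDerivAt.comp x hp).fderiv
  rw [Function.comp_def] at hcomp
  rw [totalDeriv_eq_fderiv_proj hO hfF (hxO x) hFx, hcomp]
  simp only [ContinuousLinearMap.comp_apply, ContinuousLinearMap.prod_apply,
    ContinuousLinearMap.id_apply, ContinuousLinearMap.coe_pi']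
  congr 2
  funext p
  exact (hY p.1).2 x μ

end Jets

lemma integral_fderiv_apply_eq_zero {E : Type*} [NormedAddCommGroup E] [NormedSpace ℝ E]
    [FiniteDimensional ℝ E] [MeasurableSpace E] [BorelSpace E] (m : Measure E)
    [m.IsAddHaarMeasure] {f : E → ℝ} (hf : ContDiff ℝ 1 f) (hc : HasCompactSupport f) (v : E) :
    ∫ x, fderiv ℝ f x v ∂m = 0 := by
  have hcont : Continuous fun x => fderiv ℝ f x v :=
    (hf.continuous_fderiv (by simp)).clm_apply continuous_const
  have h := integral_mul_fderiv_eq_neg_fderiv_mul_of_integrable (μ := m) (f := fun _ : E => (1 : ℝ))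
    (g := f) (v := v) (by simp) (by
      simpa using hcont.integrable_of_hasCompactSupport (hc.fderiv_apply ℝ v))
    (by simpa using hf.continuous.integrable_of_hasCompactSupport hc)
    (by simp) (fun x _ => hf.differentiable (by simp) x)
  simpa using h

/-- A total divergence has the same integral along two sections that agree outside a compact
set. -/
lemma integral_totalDeriv_sub_eq_zero {d : ℕ} {ι : Type} [Fintype ι] [DecidableEq ι]
    {Ω : Set ((Fin d → ℝ) × (ι → ℝ))} (hΩ : IsOpen Ω) {β : Fin d → Jet d ι → ℝ}
    (hβ : ∀ μ, IsLocalFunction (jetsOver Ω) (β μ))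
    {Y Z : ι × (Fin d → ℕ) → (Fin d → ℝ) → ℝ} (hY : IsHolonomic Y) (hZ : IsHolonomic Z)
    (hYΩ : ∀ x, jetSection Y x ∈ jetsOver Ω) (hZΩ : ∀ x, jetSection Z x ∈ jetsOver Ω)
    {k : Set (Fin d → ℝ)} (hk : IsCompact k) (hYZ : ∀ x ∉ k, ∀ p, Y p x = Z p x) :
    ∫ x, (∑ μ, totalDeriv μ (β μ) (jetSection Y x) -
      ∑ μ, totalDeriv μ (β μ) (jetSection Z x)) = 0 := by
  have hsec : ∀ μ, ContDiff ℝ 1 fun x => β μ (jetSection Y x) - β μ (jetSection Z x) := fun μ =>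
    ((hβ μ).comp_jetSection hΩ hY hYΩ).1.sub ((hβ μ).comp_jetSection hΩ hZ hZΩ).1
  have hsupp : ∀ μ, HasCompactSupport fun x => β μ (jetSection Y x) - β μ (jetSection Z x) :=
    fun μ => HasCompactSupport.intro hk fun x hx => by
      rw [sub_eq_zero]
      exact congrArg _ (Prod.ext rfl (funext fun p => hYZ x hx p))
  have hderiv : ∀ x, ∑ μ, totalDeriv μ (β μ) (jetSection Y x) -
      ∑ μ, totalDeriv μ (β μ) (jetSection Z x) = ∑ μ,
        fderiv ℝ (fun x => β μ (jetSection Y x) - β μ (jetSection Z x)) x (Pi.single μ 1) := by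
    intro x
    rw [← Finset.sum_sub_distrib]
    refine Finset.sum_congr rfl fun μ _ => ?_
    obtain ⟨hY1, hY2⟩ := (hβ μ).comp_jetSection hΩ hY hYΩ
    obtain ⟨hZ1, hZ2⟩ := (hβ μ).comp_jetSection hΩ hZ hZΩ
    rw [← hY2, ← hZ2, fderiv_fun_sub (hY1.differentiable (by simp) x)
      (hZ1.differentiable (by simp) x)]
    rfl
  simp only [hderiv]
  rw [integral_finsetSum]
  · exact Finset.sum_eq_zero fun μ _ => integral_fderiv_apply_eq_zero _ (hsec μ) (hsupp μ) _
  · intro μ _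
    exact (((hsec μ).continuous_fderiv (by simp)).clm_apply
      continuous_const).integrable_of_hasCompactSupport ((hsupp μ).fderiv_apply ℝ _)

/-! ### Total derivatives of functions of the scalars -/

section TotalDeriv

variable {d : ℕ} {ι : Type} [DecidableEq ι]

lemma iterTotalDeriv_zero_index (f : Jet d ι → ℝ) : iterTotalDeriv 0 f = f := by
  have : ∀ l : List (Fin d),
      l.foldr (fun μ h => (totalDeriv μ)^[(0 : Fin d → ℕ) μ] h) f = f := by
    intro l
    induction l with
    | nil => rfl
    | cons ν l ih => simp
  exact this _

lemma iterTotalDeriv_unitIdx (μ : Fin d) (f : Jet d ι → ℝ) :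
    iterTotalDeriv (unitIdx μ) f = totalDeriv μ f := by
  have : ∀ l : List (Fin d), l.Nodup →
      l.foldr (fun ν h => (totalDeriv ν)^[unitIdx μ ν] h) f =
        if μ ∈ l then totalDeriv μ f else f := by
    intro l hl
    induction l with
    | nil => rfl
    | cons ν l ih =>
      rw [List.nodup_cons] at hl
      rw [List.foldr_cons, ih hl.2]
      by_cases h : ν = μ
      · subst h
        simp [unitIdx, hl.1]
      · simp [unitIdx, h, Ne.symm h]
  rw [iterTotalDeriv, this _ (List.nodup_finRange d), if_pos (List.mem_finRange μ)]

lemma totalDeriv_zero (μ : Fin d) : totalDeriv μ (fun _ : Jet d ι => (0 : ℝ)) = fun _ => 0 := by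
  funext z
  simp [totalDeriv, pderivX, pderivY, lineDeriv]

lemma iterTotalDeriv_zero (J : Fin d → ℕ) :
    iterTotalDeriv J (fun _ : Jet d ι => (0 : ℝ)) = fun _ => 0 := by
  have : ∀ l : List (Fin d),
      l.foldr (fun μ h => (totalDeriv μ)^[J μ] h) (fun _ : Jet d ι => (0 : ℝ)) = fun _ => 0 := by
    intro l
    induction l with
    | nil => rfl
    | cons ν l ih =>
      rw [List.foldr_cons, ih]
      exact Function.iterate_fixed (totalDeriv_zero ν) _
  exact this _

end TotalDeriv

variable {N K d : ℕ}

/-- The jet coordinates `∂_J φ` of all the scalar fields. -/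
def jetScalar (J : Fin d → ℕ) : Jet d (FieldIdx N K d) →ₗ[ℝ] (ScalarIdx N K → ℝ) where
  toFun z s := z.2 (Sum.inl s, J)
  map_add' _ _ := rfl
  map_smul' _ _ := rfl

/-- The total derivative of a function of the coordinates and the undifferentiated scalars. -/
lemma totalDeriv_scalar {F : (Fin d → ℝ) × (ScalarIdx N K → ℝ) → ℝ} {z : Jet d (FieldIdx N K d)}
    (hF : DifferentiableAt ℝ F (z.1, jetScalar 0 z)) (μ : Fin d) :
    totalDeriv μ (fun w : Jet d (FieldIdx N K d) => F (w.1, jetScalar 0 w)) z =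
      fderiv ℝ F (z.1, jetScalar 0 z) (Pi.single μ 1, jetScalar (unitIdx μ) z) := by
  let S : Finset (FieldIdx N K d × (Fin d → ℕ)) :=
    Finset.univ.image fun s : ScalarIdx N K => (Sum.inl s, 0)
  have hS : ∀ s : ScalarIdx N K, ((Sum.inl s, 0) : FieldIdx N K d × (Fin d → ℕ)) ∈ S := fun s =>
    Finset.mem_image_of_mem _ (Finset.mem_univ s)
  let A : ((Fin d → ℝ) × (S → ℝ)) →L[ℝ] (Fin d → ℝ) × (ScalarIdx N K → ℝ) :=
    (ContinuousLinearMap.fst ℝ _ _).prod (ContinuousLinearMap.pi fun s =>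
      (ContinuousLinearMap.proj (⟨_, hS s⟩ : S)).comp (ContinuousLinearMap.snd ℝ _ _))
  have hA : HasFDerivAt (F ∘ A) ((fderiv ℝ F (z.1, jetScalar 0 z)).comp A) (z.proj S) :=
    HasFDerivAt.comp _ (hF.hasFDerivAt : HasFDerivAt F _ (A (z.proj S))) A.hasFDerivAt
  rw [totalDeriv_eq_fderiv_proj (f := fun w => F (w.1, jetScalar 0 w)) (F := F ∘ A) isOpen_univ
    (fun w _ => rfl) trivial hA.differentiableAt, hA.fderiv, ContinuousLinearMap.comp_apply]
  congr 1
  refine Prod.ext rfl (funext fun s => ?_)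
  change z.2 (Sum.inl s, 0 + unitIdx μ) = z.2 (Sum.inl s, unitIdx μ)
  rw [zero_add]

/-! ### The prolongation of a scalar generator -/

variable {η : (ScalarIdx N K → ℝ) → ScalarIdx N K → ℝ}

lemma scalarGenerator_characteristic_inl (s : ScalarIdx N K) :
    (scalarGenerator d η).characteristic (Sum.inl s) = fun z => η (jetScalar 0 z) s := by
  funext z
  simp only [Generator.characteristic, scalarGenerator, zero_mul, Finset.sum_const_zero, sub_zero]
  rfl

lemma scalarGenerator_coeff_inl (s : ScalarIdx N K) (J : Fin d → ℕ) :
    (scalarGenerator d η).coeff (Sum.inl s) J =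
      iterTotalDeriv J fun z => η (jetScalar 0 z) s := by
  funext z
  rw [Generator.coeff, scalarGenerator_characteristic_inl]
  simp [scalarGenerator]

lemma scalarGenerator_coeff_inr (i : GaugeIdx d) (J : Fin d → ℕ) (z : Jet d (FieldIdx N K d)) :
    (scalarGenerator d η).coeff (Sum.inr i) J z = 0 := by
  have : (scalarGenerator d η).characteristic (Sum.inr i) = fun _ => 0 := by
    funext z
    simp [Generator.characteristic, scalarGenerator]
  rw [Generator.coeff, this, iterTotalDeriv_zero]
  simp [scalarGenerator]

lemma scalarGenerator_coeff_unitIdx {z : Jet d (FieldIdx N K d)}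
    (hη : DifferentiableAt ℝ η (jetScalar 0 z)) (s : ScalarIdx N K) (μ : Fin d) :
    (scalarGenerator d η).coeff (Sum.inl s) (unitIdx μ) z =
      fderiv ℝ η (jetScalar 0 z) (jetScalar (unitIdx μ) z) s := by
  rw [scalarGenerator_coeff_inl, iterTotalDeriv_unitIdx]
  let B : ((Fin d → ℝ) × (ScalarIdx N K → ℝ)) →L[ℝ] (ScalarIdx N K → ℝ) :=
    ContinuousLinearMap.snd ℝ _ _
  have hB : HasFDerivAt (fun w => η (B w) s)
      (((ContinuousLinearMap.proj s).comp (fderiv ℝ η (jetScalar 0 z))).comp B)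
      (z.1, jetScalar 0 z) :=
    HasFDerivAt.comp (g := fun p => η p s) _ (hasFDerivAt_pi'.1 hη.hasFDerivAt s) B.hasFDerivAt
  refine (totalDeriv_scalar (F := fun w => η (B w) s) hB.differentiableAt μ).trans ?_
  rw [hB.fderiv]
  rfl

/-! ### The variation of the Lagrangian -/

lemma doublet_add (c c' : Fin 4 → ℝ) : doublet (c + c') = doublet c + doublet c' := by
  ext i
  fin_cases i <;> simp [doublet] <;> ring

lemma doublet_smul (t : ℝ) (c : Fin 4 → ℝ) : doublet (t • c) = t • doublet c := by
  ext i
  fin_cases i <;> simp [doublet] <;> ring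

/-- The `n`-th doublet as a real-linear function of all the scalars. -/
def doubletMap (n : Fin N) : (ScalarIdx N K → ℝ) →ₗ[ℝ] (Fin 2 → ℂ) where
  toFun q := doublet fun c => q (Sum.inl (n, c))
  map_add' q q' := doublet_add (fun c => q (Sum.inl (n, c))) fun c => q' (Sum.inl (n, c))
  map_smul' t q := doublet_smul t fun c => q (Sum.inl (n, c))

namespace Model

variable (P : Model N K)

/-- The covariant derivative of the `n`-th doublet in a single direction, as a real-linear
function of the values and the derivatives of the scalars, for given components `w`, `b` of the
gauge fields. -/
def covMap (w : Fin 3 → ℝ) (b : ℝ) (n : Fin N) :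
    (ScalarIdx N K → ℝ) × (ScalarIdx N K → ℝ) →ₗ[ℝ] (Fin 2 → ℂ) where
  toFun q := doubletMap n q.2
    + (Complex.I * P.g) • (∑ a, ((w a : ℂ) / 2) • (pauli a *ᵥ doubletMap n q.1))
    + (Complex.I * P.g' * P.Y * b) • doubletMap n q.1
  map_add' q q' := by
    simp only [Prod.fst_add, Prod.snd_add, map_add, Matrix.mulVec_add, smul_add,
      Finset.sum_add_distrib]
    abel
  map_smul' t q := by
    simp only [Prod.smul_fst, Prod.smul_snd, map_smul, Matrix.mulVec_smul, smul_add,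
      Finset.smul_sum, smul_comm t, RingHom.id_apply]

/-- The kinetic terms of the scalars in a single direction. -/
def kinetic (w : Fin 3 → ℝ) (b : ℝ) (q : (ScalarIdx N K → ℝ) × (ScalarIdx N K → ℝ)) : ℝ :=
  ∑ n, (star (P.covMap w b n q) ⬝ᵥ P.covMap w b n q).re + ∑ m, (1 / 2) * q.2 (Sum.inr m) ^ 2

/-- The symmetric bilinear form with `kineticPair w b q q = 2 * kinetic w b q`. -/
def kineticPair (w : Fin 3 → ℝ) (b : ℝ) (q : (ScalarIdx N K → ℝ) × (ScalarIdx N K → ℝ)) :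
    (ScalarIdx N K → ℝ) × (ScalarIdx N K → ℝ) →ₗ[ℝ] ℝ where
  toFun q' := ∑ n, 2 * (star (P.covMap w b n q) ⬝ᵥ P.covMap w b n q').re
    + ∑ m, q.2 (Sum.inr m) * q'.2 (Sum.inr m)
  map_add' q' q'' := by
    simp only [map_add, dotProduct_add, Complex.add_re, mul_add, Finset.sum_add_distrib,
      Prod.snd_add, Pi.add_apply]
    ring
  map_smul' t q' := by
    simp only [map_smul, dotProduct_smul, Complex.smul_re, Prod.smul_snd, Pi.smul_apply,
      smul_eq_mul, RingHom.id_apply, mul_add, Finset.mul_sum]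
    congr 1 <;> exact Finset.sum_congr rfl fun _ _ => by ring

lemma re_star_dotProduct_comm (a b : Fin 2 → ℂ) : (star a ⬝ᵥ b).re = (star b ⬝ᵥ a).re := by
  simp [dotProduct, Fin.sum_univ_two]
  ring

lemma kinetic_add_smul (w : Fin 3 → ℝ) (b : ℝ) (q q' : (ScalarIdx N K → ℝ) × (ScalarIdx N K → ℝ))
    (t : ℝ) :
    P.kinetic w b (q + t • q') =
      P.kinetic w b q + t * P.kineticPair w b q q' + t ^ 2 * P.kinetic w b q' := by
  have h1 : ∀ n, (star (P.covMap w b n (q + t • q')) ⬝ᵥ P.covMap w b n (q + t • q')).re =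
      (star (P.covMap w b n q) ⬝ᵥ P.covMap w b n q).re +
      t * (2 * (star (P.covMap w b n q) ⬝ᵥ P.covMap w b n q').re) +
      t ^ 2 * (star (P.covMap w b n q') ⬝ᵥ P.covMap w b n q').re := by
    intro n
    have := re_star_dotProduct_comm (P.covMap w b n q') (P.covMap w b n q)
    simp only [map_add, map_smul, star_add, star_smul, add_dotProduct, dotProduct_add,
      smul_dotProduct, dotProduct_smul, Complex.add_re, Complex.smul_re, smul_eq_mul,
      star_trivial]
    rw [this]
    ring
  simp only [kinetic, kineticPair, LinearMap.coe_mk, AddHom.coe_mk, h1, Finset.sum_add_distrib,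
    Prod.snd_add, Prod.smul_snd, Pi.add_apply, Pi.smul_apply, smul_eq_mul, mul_add,
    Finset.mul_sum]
  have h2 : ∀ m : Fin K, 1 / 2 * (q.2 (Sum.inr m) + t * q'.2 (Sum.inr m)) ^ 2 =
      1 / 2 * q.2 (Sum.inr m) ^ 2 + t * (q.2 (Sum.inr m) * q'.2 (Sum.inr m)) +
        t ^ 2 * (1 / 2 * q'.2 (Sum.inr m) ^ 2) := fun m => by ring
  simp only [h2, Finset.sum_add_distrib]
  ring

lemma lagrangian_eq (z : Jet d (FieldIdx N K d)) :
    P.lagrangian d z =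
      ∑ μ, metric μ * P.kinetic (jetW z 0 μ) (jetB z 0 μ) (jetScalar 0 z, jetScalar (unitIdx μ) z)
        - MvPolynomial.eval (jetScalar 0 z) P.V + P.gaugeKinetic z := rfl

lemma contDiff_eval_V : ContDiff ℝ ∞ fun p => MvPolynomial.eval p P.V :=
  (AnalyticOnNhd.eval_mvPolynomial P.V).contDiff

/-- The differential of the Lagrangian (with the gauge fields fixed) in the directions of the
scalars and their derivatives. -/
def dLagrangian (z : Jet d (FieldIdx N K d)) : Jet d (FieldIdx N K d) →ₗ[ℝ] ℝ :=
  ∑ μ, metric μ • (P.kineticPair (jetW z 0 μ) (jetB z 0 μ)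
      (jetScalar 0 z, jetScalar (unitIdx μ) z)).comp
        ((jetScalar 0).prod (jetScalar (unitIdx μ)))
    - (fderiv ℝ (fun p => MvPolynomial.eval p P.V) (jetScalar 0 z)).toLinearMap.comp (jetScalar 0)

lemma dLagrangian_apply (z v : Jet d (FieldIdx N K d)) :
    P.dLagrangian z v = ∑ μ, metric μ * P.kineticPair (jetW z 0 μ) (jetB z 0 μ)
        (jetScalar 0 z, jetScalar (unitIdx μ) z) (jetScalar 0 v, jetScalar (unitIdx μ) v)
      - fderiv ℝ (fun p => MvPolynomial.eval p P.V) (jetScalar 0 z) (jetScalar 0 v) := by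
  simp [dLagrangian, LinearMap.sum_apply]

lemma lineDeriv_lagrangian (z v : Jet d (FieldIdx N K d))
    (hv : ∀ i J, v.2 (Sum.inr i, J) = 0) :
    lineDeriv ℝ (P.lagrangian d) z v = P.dLagrangian z v := by
  have hW : ∀ (t : ℝ) J μ, jetW (z + t • v) J μ = jetW z J μ := fun t J μ => by
    funext a
    simp [jetW, hv]
  have hB : ∀ (t : ℝ) J μ, jetB (z + t • v) J μ = jetB z J μ := fun t J μ => by
    simp [jetB, hv]
  have hG : ∀ t : ℝ, P.gaugeKinetic (z + t • v) = P.gaugeKinetic z := fun t => by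
    simp only [gaugeKinetic, strengthW, strengthB, hW, hB]
  have hq : ∀ (t : ℝ) (μ : Fin d), (jetScalar 0 (z + t • v), jetScalar (unitIdx μ) (z + t • v)) =
      (jetScalar 0 z, jetScalar (unitIdx μ) z) +
        t • ((jetScalar 0 v, jetScalar (unitIdx μ) v) :
          (ScalarIdx N K → ℝ) × (ScalarIdx N K → ℝ)) := fun t μ => by
    simp
  have hV := (P.contDiff_eval_V.differentiable (by simp) (jetScalar 0 z)).hasFDerivAt.hasLineDerivAt
    (jetScalar 0 v)
  have hquad : ∀ a b c : ℝ, HasDerivAt (fun t : ℝ => a + t * b + t ^ 2 * c) b 0 := fun a b c => by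
    have := (((hasDerivAt_id' (0 : ℝ)).mul_const b).const_add a).fun_add
      (((hasDerivAt_id' (0 : ℝ)).fun_pow 2).mul_const c)
    simpa using this
  have hL : HasDerivAt (fun t : ℝ => P.lagrangian d (z + t • v)) (P.dLagrangian z v) 0 := by
    simp only [lagrangian_eq, hW, hB, hG, hq, kinetic_add_smul, dLagrangian_apply]
    refine ((HasDerivAt.fun_sum fun μ _ => (hquad _ _ _).const_mul (metric μ)).sub ?_).add_const _
    simp only [map_add, map_smul]
    exact hV
  exact hL.deriv

/-- The variation of the scalar kinetic term of a single direction under `δφ = η(φ)` and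
`δ(∂φ) = dη(φ) ∂φ`, at the scalar values `p` with derivatives `v` and gauge field components
`w`, `b`. -/
def kineticVariation (η : (ScalarIdx N K → ℝ) → ScalarIdx N K → ℝ) (p v : ScalarIdx N K → ℝ)
    (w : Fin 3 → ℝ) (b : ℝ) : ℝ :=
  P.kineticPair w b (p, v) (η p, fderiv ℝ η p v)

/-- The variation `η_s ∂V/∂φ_s` of the potential. -/
def potentialVariation (η : (ScalarIdx N K → ℝ) → ScalarIdx N K → ℝ) (p : ScalarIdx N K → ℝ) : ℝ :=
  fderiv ℝ (fun q => MvPolynomial.eval q P.V) p (η p)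

/-- The variation of the Lagrangian is a sum over the spacetime directions of terms that do not
depend on the dimension, weighted by the metric, minus the variation of the potential. -/
lemma variation_lagrangian {z : Jet d (FieldIdx N K d)}
    (hη : DifferentiableAt ℝ η (jetScalar 0 z)) :
    (scalarGenerator d η).variation (P.lagrangian d) z =
      ∑ μ, metric μ * P.kineticVariation η (jetScalar 0 z) (jetScalar (unitIdx μ) z)
        (jetW z 0 μ) (jetB z 0 μ) - P.potentialVariation η (jetScalar 0 z) := by
  let X := scalarGenerator d η
  -- the Lagrangian depends on the scalars only through the jet coordinates labelled by `T`
  let T : Finset (FieldIdx N K d × (Fin d → ℕ)) :=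
    (Finset.univ.image Sum.inl) ×ˢ (insert 0 (Finset.univ.image unitIdx))
  let e : FieldIdx N K d × (Fin d → ℕ) → Jet d (FieldIdx N K d) := fun p => (0, Pi.single p 1)
  have hT0 : ∀ s, (Sum.inl s, 0) ∈ T := fun s => by simp [T]
  have hT1 : ∀ s μ, (Sum.inl s, unitIdx μ) ∈ T := fun s μ => by simp [T]
  have he : ∀ s J, P.dLagrangian z (e (Sum.inl s, J)) =
      pderivY (Sum.inl s, J) (P.lagrangian d) z := fun s J =>
    (P.lineDeriv_lagrangian z (e (Sum.inl s, J)) fun i J' => by simp [e]).symm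
  have hprol : X.prolong (P.lagrangian d) z =
      ∑ᶠ p, X.coeff p.1 p.2 z * pderivY p (P.lagrangian d) z := by
    simp [Generator.prolong, X, scalarGenerator]
  have hvar : X.variation (P.lagrangian d) z = X.prolong (P.lagrangian d) z := by
    simp [Generator.variation, X, scalarGenerator, totalDeriv_zero]
  have hsupp :
      (Function.support fun p => X.coeff p.1 p.2 z * pderivY p (P.lagrangian d) z) ⊆ T := by
    rintro ⟨s | i, J⟩ hp
    · by_contra hpT
      apply hp
      have hJ : ∀ J', (Sum.inl s, J') ∈ T → jetScalar J' (e (Sum.inl s, J)) = 0 := by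
        intro J' hJ'
        funext s'
        refine Pi.single_eq_of_ne (fun h => hpT ?_) _
        rw [Prod.mk.injEq, Sum.inl.injEq] at h
        rwa [← h.2]
      simp only
      rw [← he, dLagrangian_apply, hJ 0 (hT0 s)]
      simp only [hJ _ (hT1 s _), ← Prod.zero_eq_mk, map_zero]
      simp
    · exact absurd (by simp only [X, scalarGenerator_coeff_inr, zero_mul]) hp
  have hsum : ∑ p ∈ T, X.coeff p.1 p.2 z * pderivY p (P.lagrangian d) z =
      P.dLagrangian z (∑ p ∈ T, X.coeff p.1 p.2 z • e p) := by
    rw [map_sum]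
    refine Finset.sum_congr rfl ?_
    rintro ⟨s | i, J⟩ hp
    · rw [map_smul, he, smul_eq_mul]
    · simp [T] at hp
  have hcoord : ∀ s J, (Sum.inl s, J) ∈ T →
      jetScalar J (∑ p ∈ T, X.coeff p.1 p.2 z • e p) s = X.coeff (Sum.inl s) J z := by
    intro s J hJ
    rw [map_sum, Finset.sum_apply, Finset.sum_eq_single_of_mem _ hJ]
    · simp [jetScalar, e]
    · intro p _ hp
      simp [jetScalar, e, Pi.single_eq_of_ne hp.symm]
  have h0 : jetScalar 0 (∑ p ∈ T, X.coeff p.1 p.2 z • e p) = η (jetScalar 0 z) := by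
    funext s
    rw [hcoord s 0 (hT0 s), scalarGenerator_coeff_inl, iterTotalDeriv_zero_index]
  have h1 : ∀ μ, jetScalar (unitIdx μ) (∑ p ∈ T, X.coeff p.1 p.2 z • e p) =
      fderiv ℝ η (jetScalar 0 z) (jetScalar (unitIdx μ) z) := by
    intro μ
    funext s
    rw [hcoord s _ (hT1 s μ), scalarGenerator_coeff_unitIdx hη]
  rw [hvar, hprol, finsum_eq_sum_of_support_subset _ hsupp, hsum, dLagrangian_apply, h0]
  simp only [h1]
  rfl

lemma covMap_smul (r : ℝ) (w : Fin 3 → ℝ) (b : ℝ) (n : Fin N) (p v : ScalarIdx N K → ℝ) :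
    P.covMap (r • w) (r * b) n (p, r • v) = r • P.covMap w b n (p, v) := by
  ext i
  simp only [covMap, LinearMap.coe_mk, AddHom.coe_mk, map_smul, Pi.add_apply, Pi.smul_apply,
    smul_eq_mul, Complex.real_smul, Complex.ofReal_mul, Fin.sum_univ_three]
  ring

/-- As the covariant derivative is jointly linear in `(v, w, b)`, the variation of the kinetic term
is quadratic in them. -/
lemma kineticVariation_smul (p v : ScalarIdx N K → ℝ) (w : Fin 3 → ℝ) (b r : ℝ) :
    P.kineticVariation η p (r • v) (r • w) (r * b) = r ^ 2 * P.kineticVariation η p v w b := by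
  have hs : ∀ n, 2 * (star (P.covMap (r • w) (r * b) n (p, r • v)) ⬝ᵥ
      P.covMap (r • w) (r * b) n (η p, fderiv ℝ η p (r • v))).re =
      r ^ 2 * (2 * (star (P.covMap w b n (p, v)) ⬝ᵥ
        P.covMap w b n (η p, fderiv ℝ η p v)).re) := by
    intro n
    rw [map_smul, covMap_smul, covMap_smul]
    simp only [star_smul, smul_dotProduct, dotProduct_smul, Complex.smul_re, smul_eq_mul,
      star_trivial]
    ring
  simp only [kineticVariation, kineticPair, LinearMap.coe_mk, AddHom.coe_mk, hs, mul_add,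
    Finset.mul_sum]
  congr 1
  refine Finset.sum_congr rfl fun m _ => ?_
  rw [map_smul]
  simp only [Pi.smul_apply, smul_eq_mul]
  ring

lemma kineticVariation_zero (p : ScalarIdx N K → ℝ) : P.kineticVariation η p 0 0 0 = 0 := by
  simpa using P.kineticVariation_smul (η := η) p 0 0 0 0

variable {U : Set (ScalarIdx N K → ℝ)}

lemma contDiffOn_potentialVariation (hη : ContDiffOn ℝ ∞ η U) :
    ContDiffOn ℝ ∞ (P.potentialVariation η) U :=
  (P.contDiff_eval_V.fderiv_right (m := ∞) (by simp)).contDiffOn.clm_apply hη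

lemma continuousOn_kineticVariation (hU : IsOpen U) (hη : ContDiffOn ℝ ∞ η U)
    (v : ScalarIdx N K → ℝ) (w : Fin 3 → ℝ) (b : ℝ) :
    ContinuousOn (fun p => P.kineticVariation η p v w b) U := by
  have hcov : ∀ n, Continuous (P.covMap w b n) := fun n =>
    (P.covMap w b n).continuous_of_finiteDimensional
  have h1 : ContinuousOn (fun p => fderiv ℝ η p v) U :=
    (hη.continuousOn_fderiv_of_isOpen hU (by simp)).clm_apply continuousOn_const
  have h2 : ContinuousOn (fun p => (η p, fderiv ℝ η p v)) U := hη.continuousOn.prodMk h1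
  have h3 : ∀ n, ContinuousOn (fun p => P.covMap w b n (p, v)) U := fun n =>
    ((hcov n).comp (by fun_prop)).continuousOn
  have h4 : ∀ n, ContinuousOn (fun p => P.covMap w b n (η p, fderiv ℝ η p v)) U := fun n =>
    (hcov n).comp_continuousOn h2
  simp only [kineticVariation, kineticPair, LinearMap.coe_mk, AddHom.coe_mk, dotProduct,
    Pi.star_apply]
  refine (continuousOn_finsetSum _ fun n _ => continuousOn_const.mul
    (Complex.continuous_re.comp_continuousOn (continuousOn_finsetSum _ fun i _ => ?_))).add
    (continuousOn_finsetSum _ fun m _ => continuousOn_const.mul (continuousOn_pi.1 h1 _))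
  exact (continuousOn_pi.1 (h3 n) i).star.mul (continuousOn_pi.1 (h4 n) i)

end Model

/-! ### Sections built from product test functions -/

section ProductFunctions

variable {d : ℕ}

/-- The partial derivative of order `J` of the product function `x ↦ ∏ μ, θ μ (x μ)`. -/
def prodJet (θ : Fin d → ℝ → ℝ) (J : Fin d → ℕ) (x : Fin d → ℝ) : ℝ :=
  ∏ μ, iteratedDeriv (J μ) (θ μ) (x μ)

variable {θ : Fin d → ℝ → ℝ}

lemma contDiff_prodJet (hθ : ∀ μ, ContDiff ℝ ∞ (θ μ)) (J : Fin d → ℕ) :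
    ContDiff ℝ 1 (prodJet θ J) := by
  refine contDiff_prod fun μ _ => ?_
  have : ContDiff ℝ 1 (iteratedDeriv (J μ) (θ μ)) := by
    rw [iteratedDeriv_eq_iterate]
    exact ((hθ μ).iterate_deriv (J μ)).of_le (by simp)
  exact this.comp (contDiff_apply ℝ ℝ μ)

lemma fderiv_prodJet (hθ : ∀ μ, ContDiff ℝ ∞ (θ μ)) (J : Fin d → ℕ) (x : Fin d → ℝ) (μ : Fin d) :
    fderiv ℝ (prodJet θ J) x (Pi.single μ 1) = prodJet θ (J + unitIdx μ) x := by
  have hdiff : ∀ ν, DifferentiableAt ℝ (iteratedDeriv (J ν) (θ ν)) (x ν) := fun ν =>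
    (hθ ν).differentiable_iteratedDeriv (J ν) (by exact_mod_cast WithTop.coe_lt_top _) (x ν)
  have h : ∀ ν ∈ (Finset.univ : Finset (Fin d)), HasFDerivAt
      (fun y : Fin d → ℝ => iteratedDeriv (J ν) (θ ν) (y ν))
      (iteratedDeriv (J ν + 1) (θ ν) (x ν) •
        (ContinuousLinearMap.proj ν : (Fin d → ℝ) →L[ℝ] ℝ)) x := by
    intro ν _
    rw [iteratedDeriv_succ]
    exact (hdiff ν).hasDerivAt.comp_hasFDerivAt x
      (ContinuousLinearMap.proj (R := ℝ) (φ := fun _ : Fin d => ℝ) ν).hasFDerivAt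
  have h2 := (HasFDerivAt.finsetProd h).fderiv
  rw [show prodJet θ J = fun y => ∏ ν, iteratedDeriv (J ν) (θ ν) (y ν) from rfl, h2,
    _root_.sum_apply, Finset.sum_eq_single μ]
  · rw [prodJet, ← Finset.mul_prod_erase _ _ (Finset.mem_univ μ), mul_comm]
    simp only [_root_.smul_apply, ContinuousLinearMap.proj_apply, Pi.single_eq_same,
      smul_eq_mul, mul_one, Pi.add_apply, unitIdx]
    congr 1
    refine Finset.prod_congr rfl fun ν hν => ?_
    rw [Pi.single_eq_of_ne (Finset.ne_of_mem_erase hν), add_zero]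
  · intro ν _ hν
    simp [Pi.single_eq_of_ne hν]
  · simp

lemma support_iteratedDeriv_subset_tsupport (f : ℝ → ℝ) (n : ℕ) :
    Function.support (iteratedDeriv n f) ⊆ tsupport f := by
  induction n with
  | zero => simpa using subset_tsupport f
  | succ n ih =>
    rw [iteratedDeriv_succ]
    exact support_deriv_subset.trans (closure_minimal ih (isClosed_tsupport f))

lemma prodJet_eq_zero (J : Fin d → ℕ) {x : Fin d → ℝ}
    (hx : x ∉ Set.univ.pi fun μ => tsupport (θ μ)) : prodJet θ J x = 0 := by
  simp only [Set.mem_univ_pi, not_forall] at hx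
  obtain ⟨μ, hμ⟩ := hx
  refine Finset.prod_eq_zero (Finset.mem_univ μ) ?_
  by_contra h
  exact hμ (support_iteratedDeriv_subset_tsupport _ _ h)

end ProductFunctions

variable {N K d : ℕ}

/-- The fields `φ = p + δ χ v`, `W_μ = δ ∂_μχ w`, `B_μ = δ ∂_μχ b` with all their derivatives, for
the product function `χ = ∏ μ, θ μ (x μ)`. -/
def testFields (θ : Fin d → ℝ → ℝ) (p v : ScalarIdx N K → ℝ) (w : Fin 3 → ℝ) (b δ : ℝ) :
    FieldIdx N K d × (Fin d → ℕ) → (Fin d → ℝ) → ℝ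
  | (Sum.inl s, J), x => (if J = 0 then p s else 0) + δ * v s * prodJet θ J x
  | (Sum.inr (Sum.inl (a, μ)), J), x => δ * w a * prodJet θ (J + unitIdx μ) x
  | (Sum.inr (Sum.inr μ), J), x => δ * b * prodJet θ (J + unitIdx μ) x

variable {θ : Fin d → ℝ → ℝ} {p v : ScalarIdx N K → ℝ} {w : Fin 3 → ℝ} {b δ : ℝ}

lemma unitIdx_ne_zero (μ : Fin d) : unitIdx μ ≠ 0 := fun h => by
  simpa [unitIdx] using congrFun h μ

lemma isHolonomic_testFields (hθ : ∀ μ, ContDiff ℝ ∞ (θ μ)) :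
    IsHolonomic (testFields θ p v w b δ) := by
  have hdiff : ∀ J x, DifferentiableAt ℝ (prodJet θ J) x := fun J x =>
    (contDiff_prodJet hθ J).differentiable (by simp) x
  rintro ⟨s | ⟨a, ν⟩ | ν, J⟩
  · refine ⟨contDiff_const.add (contDiff_const.mul (contDiff_prodJet hθ J)), fun x μ => ?_⟩
    change fderiv ℝ (fun x => (if J = 0 then p s else 0) + δ * v s * prodJet θ J x) x _ =
      (if J + unitIdx μ = 0 then p s else 0) + δ * v s * prodJet θ (J + unitIdx μ) x
    have hJ : J + unitIdx μ ≠ 0 := fun h => unitIdx_ne_zero μ (by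
      funext ν
      exact (Nat.add_eq_zero_iff.1 (congrFun h ν)).2)
    rw [fderiv_const_add, fderiv_const_mul (hdiff J x), if_neg hJ, zero_add, ← fderiv_prodJet hθ]
    rfl
  · refine ⟨contDiff_const.mul (contDiff_prodJet hθ _), fun x μ => ?_⟩
    change fderiv ℝ (fun x => δ * w a * prodJet θ (J + unitIdx ν) x) x _ =
      δ * w a * prodJet θ (J + unitIdx μ + unitIdx ν) x
    rw [fderiv_const_mul (hdiff _ x), add_right_comm, ← fderiv_prodJet hθ]
    rfl
  · refine ⟨contDiff_const.mul (contDiff_prodJet hθ _), fun x μ => ?_⟩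
    change fderiv ℝ (fun x => δ * b * prodJet θ (J + unitIdx ν) x) x _ =
      δ * b * prodJet θ (J + unitIdx μ + unitIdx ν) x
    rw [fderiv_const_mul (hdiff _ x), add_right_comm, ← fderiv_prodJet hθ]
    rfl

lemma testFields_eq_of_notMem {x : Fin d → ℝ} (hx : x ∉ Set.univ.pi fun μ => tsupport (θ μ))
    (q : FieldIdx N K d × (Fin d → ℕ)) :
    testFields θ p v w b δ q x = testFields θ p v w b 0 q x := by
  obtain ⟨s | ⟨a, ν⟩ | ν, J⟩ := q <;> simp [testFields, prodJet_eq_zero _ hx]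

lemma jetScalar_zero_testFields (x : Fin d → ℝ) :
    jetScalar 0 (jetSection (testFields θ p v w b δ) x) = p + (δ * prodJet θ 0 x) • v := by
  funext s
  simp [jetScalar, jetSection, testFields]
  ring

lemma jetScalar_unitIdx_testFields (x : Fin d → ℝ) (μ : Fin d) :
    jetScalar (unitIdx μ) (jetSection (testFields θ p v w b δ) x) =
      (δ * prodJet θ (unitIdx μ) x) • v := by
  funext s
  simp [jetScalar, jetSection, testFields, unitIdx_ne_zero]
  ring

lemma jetW_testFields (x : Fin d → ℝ) (μ : Fin d) :
    jetW (jetSection (testFields (N := N) (K := K) θ p v w b δ) x) 0 μ =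
      (δ * prodJet θ (unitIdx μ) x) • w := by
  funext a
  simp [jetW, jetSection, testFields]
  ring

lemma jetB_testFields (x : Fin d → ℝ) (μ : Fin d) :
    jetB (jetSection (testFields (N := N) (K := K) θ p v w b δ) x) 0 μ =
      (δ * prodJet θ (unitIdx μ) x) * b := by
  simp [jetB, jetSection, testFields]
  ring

lemma isOpen_scalarRegion {U : Set (ScalarIdx N K → ℝ)} (hU : IsOpen U) (d : ℕ) :
    IsOpen (scalarRegion d U) :=
  hU.preimage (f := fun p : (Fin d → ℝ) × (FieldIdx N K d → ℝ) => fun s => p.2 (Sum.inl s))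
    (by fun_prop)

/-- The Lorentzian square `∂_μχ ∂^μχ` of the gradient of a product function. -/
def gradSq (θ : Fin d → ℝ → ℝ) (x : Fin d → ℝ) : ℝ :=
  ∑ μ, metric μ * prodJet θ (unitIdx μ) x ^ 2

variable {U : Set (ScalarIdx N K → ℝ)} {η : (ScalarIdx N K → ℝ) → ScalarIdx N K → ℝ}

lemma variation_testFields (P : Model N K) (hU : IsOpen U) (hη : ContDiffOn ℝ ∞ η U)
    {x : Fin d → ℝ} (hx : p + (δ * prodJet θ 0 x) • v ∈ U) :
    (scalarGenerator d η).variation (P.lagrangian d) (jetSection (testFields θ p v w b δ) x) =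
      δ ^ 2 * gradSq θ x * P.kineticVariation η (p + (δ * prodJet θ 0 x) • v) v w b
        - P.potentialVariation η (p + (δ * prodJet θ 0 x) • v) := by
  rw [P.variation_lagrangian]
  · simp only [jetScalar_zero_testFields, jetScalar_unitIdx_testFields, jetW_testFields,
      jetB_testFields, P.kineticVariation_smul, gradSq, Finset.mul_sum, Finset.sum_mul]
    congr 1
    exact Finset.sum_congr rfl fun μ _ => by ring
  · rw [jetScalar_zero_testFields]
    exact (hη.contDiffAt (hU.mem_nhds hx)).differentiableAt (by simp)

/-- The integral of the variation is insensitive to compactly supported changes of the fields. -/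
lemma integral_variation_testFields (P : Model N K) (hU : IsOpen U) (hη : ContDiffOn ℝ ∞ η U)
    (hX : (scalarGenerator d η).IsVariational (scalarRegion d U) (P.lagrangian d))
    (hp : p ∈ U) (v : ScalarIdx N K → ℝ) (w : Fin 3 → ℝ) (b : ℝ)
    (hθ : ∀ μ, ContDiff ℝ ∞ (θ μ)) (hc : ∀ μ, HasCompactSupport (θ μ))
    (hδ : ∀ x, p + (δ * prodJet θ 0 x) • v ∈ U) :
    ∫ x, (δ ^ 2 * gradSq θ x * P.kineticVariation η (p + (δ * prodJet θ 0 x) • v) v w b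
      - (P.potentialVariation η (p + (δ * prodJet θ 0 x) • v) - P.potentialVariation η p)) = 0 := by
  obtain ⟨β, hβ, hXβ⟩ := hX
  have hmem : ∀ ε, (∀ x, p + (ε * prodJet θ 0 x) • v ∈ U) → ∀ x,
      jetSection (testFields θ p v w b ε) x ∈ jetsOver (scalarRegion d U) := by
    intro ε hε x
    have := hε x
    rw [← jetScalar_zero_testFields (w := w) (b := b)] at this
    exact this
  have h0 : ∀ x, p + ((0 : ℝ) * prodJet θ 0 x) • v ∈ U := fun x => by simpa using hp
  -- at `δ = 0` the test fields are constant
  have key := integral_totalDeriv_sub_eq_zero (isOpen_scalarRegion hU d) hβ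
    (isHolonomic_testFields (p := p) (v := v) (w := w) (b := b) (δ := δ) hθ)
    (isHolonomic_testFields (p := p) (v := v) (w := w) (b := b) (δ := 0) hθ)
    (hmem δ hδ) (hmem 0 h0) (isCompact_univ_pi hc) fun x hx q => testFields_eq_of_notMem hx q
  rw [← key]
  congr 1
  funext x
  rw [← hXβ _ (hmem δ hδ x), ← hXβ _ (hmem 0 h0 x), variation_testFields P hU hη (hδ x),
    variation_testFields P hU hη (h0 x)]
  simp only [zero_mul, zero_smul, add_zero, ne_eq, OfNat.ofNat_ne_zero, not_false_eq_true, zero_pow]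
  ring

/-! ### Shrinking the test fields -/

/-- If the first-order term of an integral identity in the amplitude `δ` is singled out by dividing
by `δ`, the limit `δ → 0` shows that it vanishes; if it is absent, dividing by `δ ^ 2` shows that
the second-order term vanishes. -/
lemma integral_eq_zero_of_forall_amplitude {X : Type*} [TopologicalSpace X] [MeasurableSpace X]
    [OpensMeasurableSpace X] {m : Measure X} [IsFiniteMeasureOnCompacts m]
    {k : Set X} (hk : IsCompact k) {χ I : X → ℝ} (hχ : Continuous χ) (hI : Continuous I)
    (hχk : ∀ x ∉ k, χ x = 0) (hIk : ∀ x ∉ k, I x = 0) (hχ1 : ∀ x, |χ x| ≤ 1)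
    {r : ℝ} (hr : 0 < r) {e g : ℝ → ℝ} (he : ContinuousOn e (Set.Ioo (-r) r))
    (hg : ContinuousOn g (Set.Ioo (-r) r)) (hg0 : DifferentiableAt ℝ g 0)
    (h : ∀ δ ∈ Set.Ioo (-r) r, ∫ x, (δ ^ 2 * I x * e (δ * χ x) - (g (δ * χ x) - g 0)) ∂m = 0) :
    deriv g 0 * ∫ x, χ x ∂m = 0 ∧
      ((∀ t ∈ Set.Ioo (-r) r, g t = g 0) → e 0 * ∫ x, I x ∂m = 0) := by
  have hs : Set.Ioo (-r) r ∈ nhds (0 : ℝ) := Ioo_mem_nhds (by linarith) hr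
  have h0 : (0 : ℝ) ∈ Set.Ioo (-r) r := mem_of_mem_nhds hs
  have hmaps : Set.MapsTo (fun q : ℝ × X => q.1 * χ q.2) (Set.Ioo (-r) r ×ˢ Set.univ)
      (Set.Ioo (-r) r) := by
    rintro ⟨δ, x⟩ ⟨hδ, -⟩
    rw [Set.mem_Ioo, ← abs_lt] at hδ ⊢
    calc |δ * χ x| = |δ| * |χ x| := abs_mul _ _
      _ ≤ |δ| * 1 := by gcongr; exact hχ1 x
      _ < r := by simpa using hδ
  have hmul : ContinuousOn (fun q : ℝ × X => q.1 * χ q.2) (Set.Ioo (-r) r ×ˢ Set.univ) := by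
    fun_prop
  -- a function of the amplitude that is continuous and vanishes for `δ ≠ 0` vanishes at `0`
  have hlim : ∀ F : ℝ → ℝ, ContinuousOn F (Set.Ioo (-r) r) →
      (∀ δ ∈ Set.Ioo (-r) r, δ ≠ 0 → F δ = 0) → F 0 = 0 := by
    intro F hF hF0
    have h1 : Filter.Tendsto F (nhdsWithin 0 {0}ᶜ) (nhds (F 0)) :=
      (hF.continuousAt hs).tendsto.mono_left nhdsWithin_le_nhds
    refine tendsto_nhds_unique h1 (tendsto_const_nhds.congr' ?_)
    filter_upwards [nhdsWithin_le_nhds hs, self_mem_nhdsWithin] with δ hδ hδ0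
    exact (hF0 δ hδ hδ0).symm
  constructor
  · have hG : ContinuousOn (dslope g 0) (Set.Ioo (-r) r) := (continuousOn_dslope hs).2 ⟨hg, hg0⟩
    have hcont : ContinuousOn
        (fun δ => ∫ x, (δ * I x * e (δ * χ x) - χ x * dslope g 0 (δ * χ x)) ∂m)
        (Set.Ioo (-r) r) := by
      refine continuousOn_integral_of_compact_support hk ?_ fun δ x _ hx => by
        simp [hχk x hx, hIk x hx]
      refine ContinuousOn.sub (ContinuousOn.mul (by fun_prop) (he.comp hmul hmaps))
        (ContinuousOn.mul (by fun_prop) (hG.comp hmul hmaps))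
    have := hlim _ hcont fun δ hδ hδ0 => by
      refine (mul_eq_zero.1 ?_).resolve_left hδ0
      refine Eq.trans ?_ (h δ hδ)
      rw [← integral_const_mul]
      congr 1
      funext x
      have hsl := sub_smul_dslope g 0 (δ * χ x)
      rw [sub_zero, smul_eq_mul] at hsl
      rw [← hsl]
      ring
    simp only [zero_mul, zero_sub, dslope_same, integral_neg, integral_mul_const,
      neg_eq_zero] at this
    rw [mul_comm, this]
  · intro hconst
    have hcont : ContinuousOn (fun δ => ∫ x, I x * e (δ * χ x) ∂m) (Set.Ioo (-r) r) := by
      refine continuousOn_integral_of_compact_support hk ?_ fun δ x _ hx => by simp [hIk x hx]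
      exact ContinuousOn.mul (by fun_prop) (he.comp hmul hmaps)
    have := hlim _ hcont fun δ hδ hδ0 => by
      refine (mul_eq_zero.1 ?_).resolve_left (pow_ne_zero 2 hδ0)
      refine Eq.trans ?_ (h δ hδ)
      rw [← integral_const_mul]
      congr 1
      funext x
      rw [hconst _ (hmaps (Set.mk_mem_prod hδ (Set.mem_univ x)))]
      ring
    simp only [zero_mul, integral_mul_const] at this
    rw [mul_comm, this]

/-! ### Modulated bump functions -/

/-- A smooth bump function on the line. -/
def bump : ContDiffBump (0 : ℝ) := ⟨1, 2, one_pos, one_lt_two⟩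

/-- The factors of a test function that is the modulated bump `bump * ρ` in the time direction and
`bump` in all space directions. -/
def modulated (n : ℕ) (ρ : ℝ → ℝ) : Fin (n + 1) → ℝ → ℝ :=
  Fin.cons (fun t => bump t * ρ t) fun _ => bump

variable {n : ℕ} {ρ : ℝ → ℝ}

lemma contDiff_bump : ContDiff ℝ ∞ bump := bump.contDiff

lemma contDiff_modulated (hρ : ContDiff ℝ ∞ ρ) (μ : Fin (n + 1)) :
    ContDiff ℝ ∞ (modulated n ρ μ) := by
  refine Fin.cases ?_ (fun i => ?_) μ
  · exact contDiff_bump.mul hρ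
  · exact contDiff_bump

lemma hasCompactSupport_modulated (μ : Fin (n + 1)) : HasCompactSupport (modulated n ρ μ) := by
  refine Fin.cases ?_ (fun i => ?_) μ
  · exact bump.hasCompactSupport.mul_right
  · exact bump.hasCompactSupport

lemma prodJet_modulated_zero (x : Fin (n + 1) → ℝ) :
    prodJet (modulated n ρ) 0 x = bump (x 0) * ρ (x 0) * ∏ i : Fin n, bump (x i.succ) := by
  simp [prodJet, Fin.prod_univ_succ, modulated]

lemma prodJet_modulated_unitIdx_zero (hρ : ContDiff ℝ ∞ ρ) (x : Fin (n + 1) → ℝ) :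
    prodJet (modulated n ρ) (unitIdx 0) x =
      (deriv bump (x 0) * ρ (x 0) + bump (x 0) * deriv ρ (x 0)) *
        ∏ i : Fin n, bump (x i.succ) := by
  have h := deriv_fun_mul (contDiff_bump.differentiable (by simp) (x 0))
    (hρ.differentiable (by simp) (x 0))
  simp [prodJet, Fin.prod_univ_succ, modulated, unitIdx, iteratedDeriv_one, h]

lemma prodJet_modulated_unitIdx_succ (x : Fin (n + 1) → ℝ) (j : Fin n) :
    prodJet (modulated n ρ) (unitIdx j.succ) x =
      bump (x 0) * ρ (x 0) * ∏ i : Fin n, iteratedDeriv (unitIdx j i) bump (x i.succ) := by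
  have h : ∀ i : Fin n, unitIdx j.succ i.succ = unitIdx j i := fun i => by
    simp [unitIdx, Pi.single_apply]
  simp only [prodJet, Fin.prod_univ_succ, h]
  simp [modulated, unitIdx]

/-- Modulating with a cosine and with a sine, and removing the unmodulated part, turns the
Lorentzian square of the gradient into a square, as only the time derivative sees the modulation. -/
lemma gradSq_modulated (x : Fin (n + 1) → ℝ) :
    gradSq (modulated n Real.cos) x + gradSq (modulated n Real.sin) x
      - gradSq (modulated n fun _ => 1) x = prodJet (modulated n fun _ => 1) 0 x ^ 2 := by
  have hm : metric (0 : Fin (n + 1)) = 1 := by simp [metric]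
  simp only [gradSq, Fin.sum_univ_succ, prodJet_modulated_unitIdx_zero Real.contDiff_cos,
    prodJet_modulated_unitIdx_zero Real.contDiff_sin,
    prodJet_modulated_unitIdx_zero contDiff_const, prodJet_modulated_unitIdx_succ,
    prodJet_modulated_zero, hm, Real.deriv_cos, Real.deriv_sin, deriv_const, mul_pow]
  have hsum : ∀ a : ℝ, ∑ j : Fin n, metric j.succ * (bump (x 0) ^ 2 * a *
      (∏ i : Fin n, iteratedDeriv (unitIdx j i) bump (x i.succ)) ^ 2) =
      a * ∑ j : Fin n, metric j.succ * (bump (x 0) ^ 2 *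
      (∏ i : Fin n, iteratedDeriv (unitIdx j i) bump (x i.succ)) ^ 2) := fun a => by
    rw [Finset.mul_sum]
    exact Finset.sum_congr rfl fun j _ => by ring
  simp only [hsum]
  linear_combination
    ((deriv bump (x 0) ^ 2 + bump (x 0) ^ 2) * (∏ i : Fin n, bump (x i.succ)) ^ 2 +
      ∑ j : Fin n, metric j.succ * (bump (x 0) ^ 2 *
      (∏ i : Fin n, iteratedDeriv (unitIdx j i) bump (x i.succ)) ^ 2)) *
      Real.sin_sq_add_cos_sq (x 0)

lemma abs_prodJet_modulated_le_one (hρ : ∀ t, |ρ t| ≤ 1) (x : Fin (n + 1) → ℝ) :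
    |prodJet (modulated n ρ) 0 x| ≤ 1 := by
  have hb : ∀ t : ℝ, |bump t| ≤ 1 := fun t => by
    rw [abs_of_nonneg bump.nonneg]
    exact bump.le_one
  rw [prodJet_modulated_zero, abs_mul, abs_mul, Finset.abs_prod]
  exact mul_le_one₀ (mul_le_one₀ (hb _) (abs_nonneg _) (hρ _))
    (Finset.prod_nonneg fun _ _ => abs_nonneg _)
    (Finset.prod_le_one (fun _ _ => abs_nonneg _) fun _ _ => hb _)

lemma continuous_gradSq {d : ℕ} {θ : Fin d → ℝ → ℝ} (hθ : ∀ μ, ContDiff ℝ ∞ (θ μ)) :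
    Continuous (gradSq θ) :=
  continuous_finsetSum _ fun _ _ => continuous_const.mul ((contDiff_prodJet hθ _).continuous.pow 2)

lemma gradSq_eq_zero {d : ℕ} {θ : Fin d → ℝ → ℝ} {x : Fin d → ℝ}
    (hx : x ∉ Set.univ.pi fun μ => tsupport (θ μ)) : gradSq θ x = 0 := by
  simp [gradSq, prodJet_eq_zero _ hx]

lemma integral_prodJet_pow_pos (n : ℕ) {j : ℕ} (hj : j ≠ 0) :
    0 < ∫ x, prodJet (modulated n fun _ => 1) 0 x ^ j := by
  have hc : ∀ μ, HasCompactSupport (modulated n (fun _ => 1) μ) := hasCompactSupport_modulated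
  refine Continuous.integral_pos_of_hasCompactSupport_nonneg_nonzero (x := 0)
    ((contDiff_prodJet (contDiff_modulated contDiff_const) 0).continuous.pow j)
    (HasCompactSupport.intro (isCompact_univ_pi hc) fun x hx => by
      rw [prodJet_eq_zero _ hx, zero_pow hj]) (fun x => pow_nonneg ?_ j) ?_
  · rw [prodJet_modulated_zero]
    exact mul_nonneg (mul_nonneg bump.nonneg zero_le_one)
      (Finset.prod_nonneg fun _ _ => bump.nonneg)
  · have : bump (0 : ℝ) = 1 := bump.one_of_mem_closedBall (by simp [bump])
    simp [prodJet_modulated_zero, this]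

/-! ### Symmetry criteria that do not mention the dimension -/

variable {N K d : ℕ} {U : Set (ScalarIdx N K → ℝ)} {η : (ScalarIdx N K → ℝ) → ScalarIdx N K → ℝ}

/-- The first-order and the second-order relation that the test fields yield at a point of `U`. -/
lemma test_field_relations {P : Model N K} (hU : IsOpen U) (hη : ContDiffOn ℝ ∞ η U)
    (hX : (scalarGenerator (n + 1) η).IsVariational (scalarRegion (n + 1) U)
      (P.lagrangian (n + 1)))
    {p : ScalarIdx N K → ℝ} (hp : p ∈ U) (v : ScalarIdx N K → ℝ) (w : Fin 3 → ℝ) (b : ℝ)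
    (hρ : ContDiff ℝ ∞ ρ) (hρ1 : ∀ t, |ρ t| ≤ 1) :
    fderiv ℝ (P.potentialVariation η) p v * ∫ x, prodJet (modulated n ρ) 0 x = 0 ∧
      ((∀ q ∈ U, fderiv ℝ (P.potentialVariation η) q = 0) →
        P.kineticVariation η p v w b * ∫ x, gradSq (modulated n ρ) x = 0) := by
  have hline : Continuous fun t : ℝ => p + t • v := by fun_prop
  obtain ⟨r, hr, hrU⟩ : ∃ r : ℝ, 0 < r ∧ ∀ t ∈ Set.Ioo (-r) r, p + t • v ∈ U := by
    have : (fun t : ℝ => p + t • v) ⁻¹' U ∈ nhds (0 : ℝ) :=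
      (hU.preimage hline).mem_nhds (by simpa using hp)
    obtain ⟨r, hr, h⟩ := Metric.mem_nhds_iff.1 this
    exact ⟨r, hr, fun t ht => h (by rwa [Real.ball_eq_Ioo, zero_sub, zero_add])⟩
  have hc : ∀ t ∈ Set.Ioo (-r) r, HasDerivAt (fun t : ℝ => P.potentialVariation η (p + t • v))
      (fderiv ℝ (P.potentialVariation η) (p + t • v) v) t := by
    intro t ht
    have h1 : HasDerivAt (fun t : ℝ => p + t • v) v t := by
      simpa using ((hasDerivAt_id t).smul_const v).const_add p
    exact (((P.contDiffOn_potentialVariation hη).contDiffAt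
      (hU.mem_nhds (hrU t ht))).differentiableAt (by simp)).hasFDerivAt.comp_hasDerivAt t h1
  have h0 : (0 : ℝ) ∈ Set.Ioo (-r) r := ⟨by linarith, hr⟩
  have hθ : ∀ μ, ContDiff ℝ ∞ (modulated n ρ μ) := contDiff_modulated hρ
  have hθc : ∀ μ, HasCompactSupport (modulated n ρ μ) := hasCompactSupport_modulated
  have hδ : ∀ δ ∈ Set.Ioo (-r) r, ∀ x, p + (δ * prodJet (modulated n ρ) 0 x) • v ∈ U := by
    intro δ hδ x
    refine hrU _ ?_
    rw [Set.mem_Ioo, ← abs_lt] at hδ ⊢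
    calc |δ * prodJet (modulated n ρ) 0 x| = |δ| * |prodJet (modulated n ρ) 0 x| := abs_mul _ _
      _ ≤ |δ| * 1 := by gcongr; exact abs_prodJet_modulated_le_one hρ1 x
      _ < r := by simpa using hδ
  obtain ⟨hA, hB⟩ := integral_eq_zero_of_forall_amplitude (m := volume) (isCompact_univ_pi hθc)
    (contDiff_prodJet hθ 0).continuous (continuous_gradSq hθ)
    (fun x hx => prodJet_eq_zero 0 hx) (fun x hx => gradSq_eq_zero hx)
    (abs_prodJet_modulated_le_one hρ1) hr
    (e := fun t => P.kineticVariation η (p + t • v) v w b)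
    (g := fun t => P.potentialVariation η (p + t • v))
    ((P.continuousOn_kineticVariation hU hη v w b).comp hline.continuousOn hrU)
    (fun t ht => (hc t ht).continuousAt.continuousWithinAt) (hc 0 h0).differentiableAt
    (fun δ hδ' => by
      simpa using integral_variation_testFields P hU hη hX hp v w b hθ hθc (hδ δ hδ'))
  rw [(hc 0 h0).deriv] at hA
  simp only [zero_smul, add_zero] at hA hB
  refine ⟨hA, fun hflat => hB fun t ht => ?_⟩
  have := isOpen_Ioo.is_const_of_deriv_eq_zero isPreconnected_Ioo
    (fun t ht => (hc t ht).differentiableAt.differentiableWithinAt)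
    (fun t ht => by rw [(hc t ht).deriv, hflat _ (hrU t ht)]; rfl) ht h0
  simpa using this

lemma isVariational_iff {P : Model N K} (hU : IsOpen U) (hη : ContDiffOn ℝ ∞ η U) (hd : 1 ≤ d) :
    (scalarGenerator d η).IsVariational (scalarRegion d U) (P.lagrangian d) ↔
      (∀ p ∈ U, ∀ v w b, P.kineticVariation η p v w b = 0) ∧
        ∀ p ∈ U, fderiv ℝ (P.potentialVariation η) p = 0 := by
  obtain ⟨n, rfl⟩ : ∃ n, d = n + 1 := ⟨d - 1, by omega⟩
  constructor
  · intro hX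
    have hflat : ∀ p ∈ U, fderiv ℝ (P.potentialVariation η) p = 0 := by
      intro p hp
      ext v
      have := (test_field_relations hU hη hX hp v 0 0 (ρ := fun _ => 1) contDiff_const
        (by simp)).1
      have hpos := integral_prodJet_pow_pos n one_ne_zero
      simp only [pow_one] at hpos
      exact (mul_eq_zero.1 this).resolve_right hpos.ne'
    refine ⟨fun p hp v w b => ?_, hflat⟩
    have hrel : ∀ ρ : ℝ → ℝ, ContDiff ℝ ∞ ρ → (∀ t, |ρ t| ≤ 1) →
        P.kineticVariation η p v w b * ∫ x, gradSq (modulated n ρ) x = 0 := fun ρ hρ hρ1 =>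
      (test_field_relations hU hη hX hp v w b hρ hρ1).2 hflat
    have hint : ∀ ρ : ℝ → ℝ, ContDiff ℝ ∞ ρ → Integrable (gradSq (modulated n ρ)) := fun ρ hρ =>
      (continuous_gradSq (contDiff_modulated hρ)).integrable_of_hasCompactSupport
        (HasCompactSupport.intro (isCompact_univ_pi hasCompactSupport_modulated)
          fun x hx => gradSq_eq_zero hx)
    have hsq : ∫ x, prodJet (modulated n fun _ => 1) 0 x ^ 2 =
        (∫ x, gradSq (modulated n Real.cos) x) + (∫ x, gradSq (modulated n Real.sin) x)
          - ∫ x, gradSq (modulated n fun _ => 1) x := by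
      simp only [← gradSq_modulated]
      rw [integral_sub (f := fun x => gradSq (modulated n Real.cos) x +
          gradSq (modulated n Real.sin) x)
        ((hint _ Real.contDiff_cos).add (hint _ Real.contDiff_sin))
        (hint (fun _ => 1) contDiff_const),
        integral_add (hint _ Real.contDiff_cos) (hint _ Real.contDiff_sin)]
    have hpos := integral_prodJet_pow_pos n two_ne_zero
    refine (mul_eq_zero.1 ?_).resolve_right hpos.ne'
    rw [hsq]
    linear_combination hrel _ Real.contDiff_cos Real.abs_cos_le_one +
      hrel _ Real.contDiff_sin Real.abs_sin_le_one - hrel (fun _ => 1) contDiff_const (by simp)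
  · rintro ⟨hkin, hflat⟩
    have hdiff : ∀ p ∈ U, DifferentiableAt ℝ (P.potentialVariation η) p := fun p hp =>
      ((P.contDiffOn_potentialVariation hη).contDiffAt (hU.mem_nhds hp)).differentiableAt (by simp)
    -- `∑ μ, κ μ = -1`, so that `β^μ = κ_μ x^μ η_s ∂V/∂φ_s` has the required divergence
    let κ : Fin (n + 1) → ℝ := Pi.single 0 (-1)
    let B : Fin (n + 1) → (Fin (n + 1) → ℝ) × (ScalarIdx N K → ℝ) → ℝ := fun μ q =>
      κ μ * q.1 μ * P.potentialVariation η q.2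
    refine ⟨fun μ z => B μ (z.1, jetScalar 0 z), fun μ => ?_, fun z hz => ?_⟩
    · let S : Finset (FieldIdx N K (n + 1) × (Fin (n + 1) → ℕ)) :=
        Finset.univ.image fun s : ScalarIdx N K => (Sum.inl s, 0)
      have hS : ∀ s : ScalarIdx N K,
          ((Sum.inl s, 0) : FieldIdx N K (n + 1) × (Fin (n + 1) → ℕ)) ∈ S := fun s =>
        Finset.mem_image_of_mem _ (Finset.mem_univ s)
      refine ⟨S, fun q => B μ (q.1, fun s => q.2 ⟨_, hS s⟩), ?_, fun z _ => rfl⟩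
      refine ContDiffOn.mul (by fun_prop) ((P.contDiffOn_potentialVariation hη).comp
        (ContDiff.contDiffOn (by fun_prop)) ?_)
      rintro _ ⟨z, hz, rfl⟩
      exact hz
    · have hzU : jetScalar 0 z ∈ U := hz
      have hβ : ∀ μ, totalDeriv μ (fun z => B μ (z.1, jetScalar 0 z)) z =
          κ μ * P.potentialVariation η (jetScalar 0 z) := by
        intro μ
        have h1 : HasFDerivAt (fun q : (Fin (n + 1) → ℝ) × (ScalarIdx N K → ℝ) => κ μ * q.1 μ)
            (κ μ • (ContinuousLinearMap.proj (R := ℝ) (φ := fun _ : Fin (n + 1) => ℝ) μ).comp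
              (ContinuousLinearMap.fst ℝ _ (ScalarIdx N K → ℝ))) (z.1, jetScalar 0 z) :=
          (((ContinuousLinearMap.proj (R := ℝ) (φ := fun _ : Fin (n + 1) => ℝ) μ).comp
            (ContinuousLinearMap.fst ℝ _ (ScalarIdx N K → ℝ))).hasFDerivAt).const_mul (κ μ)
        have h2 : HasFDerivAt (fun q : (Fin (n + 1) → ℝ) × (ScalarIdx N K → ℝ) =>
            P.potentialVariation η q.2) (0 : _ →L[ℝ] ℝ) (z.1, jetScalar 0 z) := by
          have h3 := (hdiff _ hzU).hasFDerivAt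
          rw [hflat _ hzU] at h3
          have h4 := h3.comp (z.1, jetScalar 0 z)
            (ContinuousLinearMap.snd ℝ (Fin (n + 1) → ℝ) (ScalarIdx N K → ℝ)).hasFDerivAt
          simpa [Function.comp_def] using h4
        have h5 := h1.fun_mul h2
        refine (totalDeriv_scalar (F := B μ) h5.differentiableAt μ).trans
          ((DFunLike.congr_fun h5.fderiv _).trans ?_)
        simp
        ring
      simp only [hβ]
      rw [P.variation_lagrangian (((hη.contDiffAt (hU.mem_nhds hzU))).differentiableAt (by simp)),
        ← Finset.sum_mul]
      simp [hkin _ hzU, κ]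

lemma isStrictVariational_iff {P : Model N K} (hU : IsOpen U) (hη : ContDiffOn ℝ ∞ η U)
    (hd : 1 ≤ d) :
    (scalarGenerator d η).IsStrictVariational (scalarRegion d U) (P.lagrangian d) ↔
      (∀ p ∈ U, ∀ v w b, P.kineticVariation η p v w b = 0) ∧
        ∀ p ∈ U, P.potentialVariation η p = 0 := by
  have hdiff : ∀ p ∈ U, DifferentiableAt ℝ η p := fun p hp =>
    (hη.contDiffAt (hU.mem_nhds hp)).differentiableAt (by simp)
  let μ₀ : Fin d := ⟨0, hd⟩
  constructor
  · intro h
    -- a jet whose only non-zero derivatives and gauge fields are those in the time direction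
    let z : (ScalarIdx N K → ℝ) → (ScalarIdx N K → ℝ) → (Fin 3 → ℝ) → ℝ →
        Jet d (FieldIdx N K d) := fun p v w b => (0, fun q => match q.1 with
      | Sum.inl s => if q.2 = 0 then p s else if q.2 = unitIdx μ₀ then v s else 0
      | Sum.inr (Sum.inl (a, μ)) => if μ = μ₀ then w a else 0
      | Sum.inr (Sum.inr μ) => if μ = μ₀ then b else 0)
    have h0 : ∀ p v w b, jetScalar 0 (z p v w b) = p := fun p v w b => by
      funext s
      simp [jetScalar, z]
    have h1 : ∀ p v w b μ, jetScalar (unitIdx μ) (z p v w b) = if μ = μ₀ then v else 0 := by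
      intro p v w b μ
      funext s
      have : unitIdx μ = unitIdx μ₀ ↔ μ = μ₀ := by
        refine ⟨fun h => ?_, fun h => by rw [h]⟩
        by_contra hne
        simpa [unitIdx, Pi.single_eq_of_ne hne] using congrFun h μ
      by_cases hμ : μ = μ₀ <;> simp [jetScalar, z, unitIdx_ne_zero, this, hμ]
    have h2 : ∀ p v w b μ, jetW (z p v w b) 0 μ = if μ = μ₀ then w else 0 := by
      intro p v w b μ
      funext a
      by_cases hμ : μ = μ₀ <;> simp [jetW, z, hμ]
    have h3 : ∀ p v w b μ, jetB (z p v w b) 0 μ = if μ = μ₀ then b else 0 := fun p v w b μ => rfl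
    have key : ∀ p ∈ U, ∀ v w b,
        P.kineticVariation η p v w b - P.potentialVariation η p = 0 := by
      intro p hp v w b
      have hz : z p v w b ∈ jetsOver (scalarRegion d U) := by
        have := hp
        rw [← h0 p v w b] at this
        exact this
      have := h _ hz
      rw [P.variation_lagrangian (by rw [h0]; exact hdiff p hp), h0,
        Finset.sum_eq_single μ₀] at this
      · simpa [h1, h2, h3, metric, μ₀] using this
      · intro μ _ hμ
        simp [h1, h2, h3, hμ, P.kineticVariation_zero]
      · simp
    have hpot : ∀ p ∈ U, P.potentialVariation η p = 0 := fun p hp => by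
      simpa [P.kineticVariation_zero] using key p hp 0 0 0
    exact ⟨fun p hp v w b => by simpa [hpot p hp] using key p hp v w b, hpot⟩
  · rintro ⟨hkin, hpot⟩ z hz
    have hzU : jetScalar 0 z ∈ U := hz
    rw [P.variation_lagrangian (hdiff _ hzU)]
    simp [hkin _ hzU, hpot _ hzU]

end NHDM

end

theorem proposition1 (N K : ℕ) (P : NHDM.Model N K) (U : Set (NHDM.ScalarIdx N K → ℝ))
    (hU : IsOpen U) (d d' : ℕ) (hd : 1 ≤ d) (hd' : 1 ≤ d') :
    P.strictScalarSymmetries d U = P.strictScalarSymmetries d' U ∧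
    P.divergenceScalarSymmetries d U = P.divergenceScalarSymmetries d' U ∧
    P.variationalScalarSymmetries d U = P.variationalScalarSymmetries d' U := by
  refine ⟨Set.ext fun η => and_congr_right fun hη => ?_,
    Set.ext fun η => and_congr_right fun hη => ?_, Set.ext fun η => and_congr_right fun hη => ?_⟩
  · rw [NHDM.isStrictVariational_iff hU hη hd, NHDM.isStrictVariational_iff hU hη hd']
  · rw [NHDM.Generator.IsDivergence, NHDM.Generator.IsDivergence,
      NHDM.isStrictVariational_iff hU hη hd, NHDM.isStrictVariational_iff hU hη hd',
      NHDM.isVariational_iff hU hη hd, NHDM.isVariational_iff hU hη hd']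
  · rw [NHDM.isVariational_iff hU hη hd, NHDM.isVariational_iff hU hη hd']
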